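/- Let $(M,\omega)$ be a connected finite-dimensional smooth symplectic manifold and let $\mathfrak g$ be a finite-dimensional abelian real Lie algebra with a complete weakly Hamiltonian action on $(M,\omega)$: a linear map $u\mapsto X_u$ from $\mathfrak g$ to complete, pairwise commuting smooth vector fields on $M$, together with a linear map $\rho\colon \mathfrak g\to C^\infty(M)$, $u\mapsto H_u$, such that $dH_u=\iota_{X_u}\omega$. Its cocycle is $c(u,v)=\{H_u,H_v\}-H_{[u,v]}=\{H_u,H_v\}$, where $\{H_u,H_v\}=\omega(X_u,X_v)$. Then $c(u,v)$ is a constant function for all $u,v\in\mathfrak g$, so that $c\in\wedge^2\mathfrak g^*$. Let $V\subset\mathfrak g$ be any linear subspace complementary to $\ker c=\{u\in\mathfrak g : c(u,\cdot)=0\}$, and let $u\mapsto u_V$ be the projection of $\mathfrak g$ onto $V$ along $\ker c$. Then $(V,c|_V)$ is a symplectic vector space, the set $$N=\{x\in M : H_v(x)=0 \text{ for all } v\in V\}$$ is an embedded submanifold of $M$ on which $\omega|_N$ is symplectic, and there are a diffeomorphism $\Phi\colon M\to V\times N$ with $\Phi(n)=(0,n)$ for $n\in N$ and a complete weakly Hamiltonian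 action of $\mathfrak g$ on $(N,\omega|_N)$, with vector fields $X^N_u$ and Hamiltonian functions $H^N_u$, such that: 1. $\Phi\colon (M,\omega)\to (V\times N,\ c|_V\oplus\omega|_N)$ is a symplectomorphism; 2. the action on $N$ is Hamiltonian, i.e. $\{H^N_u,H^N_v\}=H^N_{[u,v]}=0$ for all $u,v\in\mathfrak g$, and $X^N_v=0$ for $v\in V$; 3. $\Phi$ splits the action into the standard action by translations on $(V,c|_V)$ and the action on $N$: for all $u\in\mathfrak g$, $\Phi_*X_u=(u_V,\,X^N_u)$, where $u_V$ is viewed as a constant vector field on $V$, and $H_u(\Phi^{-1}(v,n))=c(u_V,v)+H^N_u(n)$ for all $v\in V$, $n\in N$. -/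

import Mathlib

open scoped Manifold ContDiff

/-- A Lie ring whose underlying additive group carries a norm. No compatibility between norm and
bracket is asked for: on a finite-dimensional real Lie algebra the norm only serves to name the
standard topology and smooth structure of the underlying vector space. -/
class NormedLieRing (g : Type*) extends NormedAddCommGroup g, LieRing g

/-- A real Lie algebra whose underlying vector space is normed. -/
class NormedLieAlgebra (g : Type*) [NormedLieRing g] extends NormedSpace ℝ g, LieAlgebra ℝ g

section

variable {E F M N : Type*}
  [NormedAddCommGroup E] [NormedSpace ℝ E] [TopologicalSpace M] [ChartedSpace E M]
  [NormedAddCommGroup F] [NormedSpace ℝ F] [TopologicalSpace N] [ChartedSpace F N]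

variable (E M) in
/-- A (not necessarily smooth) differential 2-form on a manifold `M` modelled on `E`. -/
abbrev TwoForm := ∀ x : M, (TangentSpace 𝓘(ℝ, E) x) [⋀^Fin 2]→L[ℝ] ℝ

namespace TwoForm

/-- The pullback `f^* σ`. -/
noncomputable def pullback (f : N → M) (σ : TwoForm E M) : TwoForm F N := fun x ↦
  (σ (f x)).compContinuousLinearMap (mfderiv 𝓘(ℝ, F) 𝓘(ℝ, E) f x)

/-- The expression of `σ` in the preferred chart at `x₀`, a 2-form on the model vector space
(meaningful on the target of the chart). -/
noncomputable def inChart (σ : TwoForm E M) (x₀ : M) : E → E [⋀^Fin 2]→L[ℝ] ℝ :=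
  pullback (F := E) (extChartAt 𝓘(ℝ, E) x₀).symm σ

/-- A symplectic form: a smooth, closed, nondegenerate 2-form. -/
structure IsSymplectic (σ : TwoForm E M) : Prop where
  smooth : ∀ x₀ : M, ContDiffOn ℝ ∞ (σ.inChart x₀) (extChartAt 𝓘(ℝ, E) x₀).target
  closed : ∀ x₀ : M, ∀ y ∈ (extChartAt 𝓘(ℝ, E) x₀).target, extDeriv (σ.inChart x₀) y = 0
  nondegenerate : ∀ (x : M) (a : TangentSpace 𝓘(ℝ, E) x),
    (∀ b : TangentSpace 𝓘(ℝ, E) x, σ x ![a, b] = 0) → a = 0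

/-- `X` is the Hamiltonian vector field of `H`, with the sign convention `dH = ι_X σ`. -/
def IsHamiltonianVectorField (σ : TwoForm E M) (H : M → ℝ)
    (X : ∀ x : M, TangentSpace 𝓘(ℝ, E) x) : Prop :=
  ∀ (x : M) (w : TangentSpace 𝓘(ℝ, E) x),
    (mfderiv 𝓘(ℝ, E) 𝓘(ℝ, ℝ) H x w : ℝ) = σ x ![X x, w]

end TwoForm

/-- A weakly Hamiltonian (infinitesimal) action of a Lie algebra `g` on `(M, σ)`, together with a
linear choice `u ↦ H_u` of Hamiltonian functions for its fundamental vector fields `X_u`.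

With the conventions `dH_u = ι_{X_u} σ` and `{H_u, H_v} = σ(X_u, X_v)` the Hamiltonian vector field
of `{H_u, H_v}` is `-[X_u, X_v]`; this is the reason for the sign in `map_lie`. -/
structure WeaklyHamiltonianAction [IsManifold 𝓘(ℝ, E) ∞ M] (σ : TwoForm E M) (g : Type*) [NormedLieRing g]
    [NormedLieAlgebra g] where
  /-- the fundamental vector fields `X_u` -/
  vectorField : g →ₗ[ℝ] (∀ x : M, TangentSpace 𝓘(ℝ, E) x)
  smooth_vectorField : ∀ u : g, ContMDiff 𝓘(ℝ, E) 𝓘(ℝ, E).tangent ∞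
    (fun x ↦ (⟨x, vectorField u x⟩ : TangentBundle 𝓘(ℝ, E) M))
  map_lie : ∀ u v : g, vectorField ⁅u, v⁆ =
    -VectorField.mlieBracket 𝓘(ℝ, E) (vectorField u) (vectorField v)
  /-- the Hamiltonian functions `H_u` -/
  hamiltonian : g →ₗ[ℝ] C^∞⟮𝓘(ℝ, E), M; 𝓘(ℝ, ℝ), ℝ⟯
  isHamiltonianVectorField : ∀ u : g,
    σ.IsHamiltonianVectorField (hamiltonian u) (vectorField u)

namespace WeaklyHamiltonianAction

variable [IsManifold 𝓘(ℝ, E) ∞ M] {σ : TwoForm E M} {g : Type*} [NormedLieRing g] [NormedLieAlgebra g]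
  (ρ : WeaklyHamiltonianAction σ g)

/-- All fundamental vector fields are complete. -/
def IsComplete : Prop :=
  ∀ (u : g) (x : M), ∃ γ : ℝ → M, γ 0 = x ∧ IsMIntegralCurve (I := 𝓘(ℝ, E)) γ (ρ.vectorField u)

/-- The function `{H_u, H_v} - H_{[u, v]}` on `M`, where `{H_u, H_v} = σ(X_u, X_v)`. -/
noncomputable def cocycle (u v : g) (x : M) : ℝ :=
  σ x ![ρ.vectorField u x, ρ.vectorField v x] - ρ.hamiltonian ⁅u, v⁆ x

/-- The action is Hamiltonian (with the given Hamiltonian functions): `u ↦ H_u` is a morphism of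
Lie algebras, that is, the cocycle vanishes. -/
def IsHamiltonian : Prop := ∀ (u v : g) (x : M), ρ.cocycle u v x = 0

/-- The common zero set of the functions `H_v`, `v ∈ V`. -/
def zeroLevel (V : Submodule ℝ g) : Set M := {x | ∀ v ∈ V, ρ.hamiltonian v x = 0}

end WeaklyHamiltonianAction

end

/-!
Symplectic splitting of a weakly Hamiltonian action of an abelian Lie algebra.

The Poisson bracket `σ(X_u, X_v)` has Hamiltonian vector field `-[X_u, X_v] = 0`
(`TwoForm.IsSymplectic.hasMFDerivAt_poisson`), so on the connected manifold `M` it is a constant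
`c u v`. Hence every `H_w` is affine along the flow of `X_u`. That flow preserves `σ`
(`IsFlow.apply_mfderiv_mfderiv`) and changes `H_w` only by a constant, so it preserves `X_w`
(`IsFlow.mfderiv_apply_of_poisson_const`). Therefore the flows commute and integrate the Lie algebra
action to an action `act` of the additive group of `g`, with
`H_w (act u x) = H_w x + c w u`.

Since `c` is nondegenerate on `V`, the functions `H_w`, `w ∈ V`, are encoded by one map
`h : M → V` with `c w (h x) = H_w x`, and `h (act u x) = h x + u_V`. So `V` acts freely, `h` is a
submersion, its zero level is `N`, and moving `x` by `-(h x)` is a retraction `r` of `M` onto `N`.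
The diffeomorphism is `x ↦ (h x, r x)`, with inverse `(v, n) ↦ act v n`. Every tangent vector at
`x` is the sum of some `X_w`, `w ∈ V`, and the translate of a vector tangent to `N`; as
`σ(X_w, ·) = dH_w` vanishes on the latter, `σ` splits
(`WeaklyHamiltonianAction.IsMomentumMap.apply_eq_add`). The fields `X_u` project under `r` to
vector fields on `N`, with Hamiltonian functions the restrictions of the `H_u`; on `N` the
projected field equals `X_{u - u_V}`, and `u - u_V` lies in the kernel of `c`, so that their
brackets vanish.

Two pieces of general theory are developed on the way. Flows of complete smooth vector fields
are jointly smooth (`IsFlow.contMDiff`): the integral equation is solved by the inverse function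
theorem in the space of continuous curves, where superposition with a smooth map is smooth. Regular
level sets are embedded submanifolds (`exists_isManifold_of_regular`).
-/

/-! ### Superposition operators on spaces of continuous curves -/

section Superposition

open Topology

universe u v

variable {K : Type*} [TopologicalSpace K] [CompactSpace K]

/-- Pointwise evaluation `(A, h) ↦ (t ↦ A t (h t))` of a continuous family of operators on a
continuous curve, as a continuous bilinear map. -/
noncomputable def ContinuousMap.pointwiseApply (K : Type*) [TopologicalSpace K] [CompactSpace K]
    (W F : Type*) [NormedAddCommGroup W] [NormedSpace ℝ W] [NormedAddCommGroup F]
    [NormedSpace ℝ F] : C(K, W →L[ℝ] F) →L[ℝ] C(K, W) →L[ℝ] C(K, F) :=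
  LinearMap.mkContinuous₂
    (LinearMap.mk₂ ℝ (fun (A : C(K, W →L[ℝ] F)) (h : C(K, W)) ↦
        (⟨fun t ↦ A t (h t), by fun_prop⟩ : C(K, F)))
      (fun A A' h ↦ by ext t; simp) (fun c A h ↦ by ext t; simp)
      (fun A h h' ↦ by ext t; simp) (fun c A h ↦ by ext t; simp)) 1
    (fun A h ↦ by
      refine (ContinuousMap.norm_le _ (by positivity)).2 fun t ↦ ?_
      rw [one_mul]
      exact ((A t).le_opNorm _).trans (mul_le_mul (A.norm_coe_le_norm t) (h.norm_coe_le_norm t)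
        (norm_nonneg _) (by positivity)))

@[simp] lemma ContinuousMap.pointwiseApply_apply {W F : Type*} [NormedAddCommGroup W]
    [NormedSpace ℝ W] [NormedAddCommGroup F] [NormedSpace ℝ F]
    (A : C(K, W →L[ℝ] F)) (h : C(K, W)) (t : K) :
    ContinuousMap.pointwiseApply K W F A h t = A t (h t) := rfl

/-- The superposition operator of a `C^1` function is differentiable. -/
lemma ContinuousMap.hasFDerivAt_comp {W F : Type*} [NormedAddCommGroup W]
    [NormedSpace ℝ W] [NormedAddCommGroup F] [NormedSpace ℝ F] (f : C(W, F)) (f' : C(W, W →L[ℝ] F))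
    (hf : ∀ w, HasFDerivAt f (f' w) w) (γ : C(K, W)) :
    HasFDerivAt (fun γ : C(K, W) ↦ f.comp γ)
      (ContinuousMap.pointwiseApply K W F (f'.comp γ)) γ := by
  rw [hasFDerivAt_iff_isLittleO_nhds_zero, Asymptotics.isLittleO_iff]
  intro ε hε
  have hc : Filter.Tendsto (fun h : C(K, W) ↦ f'.comp (γ + h)) (𝓝 0) (𝓝 (f'.comp γ)) := by
    have : Continuous fun h : C(K, W) ↦ f'.comp (γ + h) :=
      (ContinuousMap.continuous_postcomp f').comp (by fun_prop)
    simpa using this.tendsto 0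
  obtain ⟨δ, hδ, H⟩ := Metric.eventually_nhds_iff.1
    (hc (Metric.ball_mem_nhds (f'.comp γ) hε))
  filter_upwards [Metric.ball_mem_nhds (0 : C(K, W)) hδ] with h hh
  rw [ContinuousMap.norm_le _ (by positivity)]
  intro t
  have key : ∀ w ∈ segment ℝ (γ t) (γ t + h t), ‖f' w - f' (γ t)‖ ≤ ε := by
    intro w hw
    rw [segment_eq_image'] at hw
    obtain ⟨s, ⟨hs0, hs1⟩, rfl⟩ := hw
    -- the perturbation by `s • h` is as small as the one by `h`
    have hs : dist (s • h) 0 < δ := by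
      rw [dist_zero_right, norm_smul, Real.norm_of_nonneg hs0]
      refine (mul_le_of_le_one_left (norm_nonneg _) hs1).trans_lt (by simpa using hh)
    have h1 := H hs
    have h2 := (ContinuousMap.dist_apply_le_dist t).trans (Metric.mem_ball.1 h1).le
    simpa [dist_eq_norm] using h2
  have := (convex_segment (γ t) (γ t + h t)).norm_image_sub_le_of_norm_hasFDerivWithin_le'
    (fun w _ ↦ (hf w).hasFDerivWithinAt) key (left_mem_segment ℝ _ _) (right_mem_segment ℝ _ _)
  simp only [add_sub_cancel_left] at this
  refine le_trans ?_ (this.trans (mul_le_mul_of_nonneg_left (h.norm_coe_le_norm t) hε.le))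
  simp

/-- The superposition operator `γ ↦ f ∘ γ` of a smooth function `f` is smooth on the Banach space
of continuous curves: its derivative is the superposition operator of `fderiv ℝ f`, followed by a
bounded linear map. -/
theorem ContinuousMap.contDiff_comp {W : Type u} {F : Type (max u v)} [NormedAddCommGroup W]
    [NormedSpace ℝ W] [NormedAddCommGroup F] [NormedSpace ℝ F] (f : C(W, F)) (hf : ContDiff ℝ ∞ f) :
    ContDiff ℝ ∞ (fun γ : C(K, W) ↦ f.comp γ) := by
  rw [contDiff_infty]
  intro n
  induction n generalizing F with
  | zero => exact contDiff_zero.2 (ContinuousMap.continuous_postcomp f)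
  | succ n ih =>
    let f' : C(W, W →L[ℝ] F) := ⟨fderiv ℝ f, hf.continuous_fderiv (by simp)⟩
    have hf' : ContDiff ℝ ∞ f' := hf.fderiv_right (by simp)
    have hd := ContinuousMap.hasFDerivAt_comp (K := K) f f'
      (fun w ↦ (hf.differentiable (by simp) w).hasFDerivAt)
    rw [Nat.cast_succ, contDiff_succ_iff_hasFDerivAt]
    refine ⟨fun γ ↦ ContinuousMap.pointwiseApply K W F (f'.comp γ), ?_, hd⟩
    exact (ContinuousMap.pointwiseApply K W F).contDiff.comp (ih f' hf')

end Superposition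

/-! ### Smooth dependence of solutions of an autonomous equation on time scale and initial value -/

section SmoothDependence

open Topology Set

variable {E : Type*} [NormedAddCommGroup E] [NormedSpace ℝ E]

/-- The time interval on which solutions are constructed: it contains `0` and `1` in its
interior. -/
abbrev TimeInterval : Type := Icc (-2 : ℝ) 2

/-- The retraction of `ℝ` onto the time interval. -/
noncomputable def TimeInterval.proj (t : ℝ) : TimeInterval := projIcc (-2) 2 (by norm_num) t

lemma TimeInterval.continuous_proj : Continuous TimeInterval.proj := by
  unfold TimeInterval.proj
  exact continuous_projIcc

variable (E) in
/-- The operator `γ ↦ (t ↦ ∫ s in 0..t, γ s)` on continuous curves. -/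
noncomputable def TimeInterval.primitive : C(TimeInterval, E) →L[ℝ] C(TimeInterval, E) :=
  have hint : ∀ (γ : C(TimeInterval, E)) (a b : ℝ), IntervalIntegrable
      (fun s ↦ γ (TimeInterval.proj s)) MeasureTheory.volume a b := fun γ a b ↦
    (γ.continuous.comp TimeInterval.continuous_proj).intervalIntegrable a b
  LinearMap.mkContinuous
    { toFun := fun γ ↦ ⟨fun t ↦ ∫ s in (0 : ℝ)..t, γ (TimeInterval.proj s),
        (intervalIntegral.continuous_primitive (hint γ) 0).comp continuous_subtype_val⟩
      map_add' := fun γ γ' ↦ by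
        ext t
        simp [intervalIntegral.integral_add (hint γ _ _) (hint γ' _ _)]
      map_smul' := fun c γ ↦ by
        ext t
        simp } 2
    (fun γ ↦ by
      refine (ContinuousMap.norm_le _ (by positivity)).2 fun t ↦ ?_
      refine (intervalIntegral.norm_integral_le_of_norm_le_const
        (fun s _ ↦ γ.norm_coe_le_norm (TimeInterval.proj s))).trans ?_
      rw [mul_comm]
      refine mul_le_mul_of_nonneg_right ?_ (by positivity)
      rw [sub_zero, abs_le]
      exact t.2)

lemma TimeInterval.primitive_apply (γ : C(TimeInterval, E)) (t : TimeInterval) :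
    TimeInterval.primitive E γ t = ∫ s in (0 : ℝ)..t, γ (TimeInterval.proj s) := rfl

variable (E) in
/-- The constant curves, as a continuous linear map. -/
noncomputable def TimeInterval.constCurve : E →L[ℝ] C(TimeInterval, E) :=
  LinearMap.mkContinuous
    { toFun := fun x ↦ ContinuousMap.const _ x
      map_add' := fun _ _ ↦ rfl
      map_smul' := fun _ _ ↦ rfl } 1
    (fun x ↦ (ContinuousMap.norm_le _ (by positivity)).2 fun t ↦ by rw [one_mul]; exact le_rfl)

@[simp] lemma TimeInterval.constCurve_apply (x : E) (t : TimeInterval) :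
    TimeInterval.constCurve E x t = x := rfl

/-- The solutions `γ` of `γ' = τ • X γ`, `γ 0 = x`, on a fixed time interval, depend smoothly on
`(τ, x)` near `τ = 0`, as points of the Banach space of continuous curves. At `τ = 0` the
derivative of the integral equation in `γ` is the identity, so this is the inverse function
theorem, and no smallness of the time interval is needed. -/
theorem exists_contDiffAt_solution [CompleteSpace E] {X : E → E} (hX : ContDiff ℝ ∞ X) (x₀ : E) :
    ∃ f : ℝ × E → C(TimeInterval, E), ContDiffAt ℝ ∞ f (0, x₀) ∧
      f (0, x₀) = TimeInterval.constCurve E x₀ ∧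
      ∀ᶠ p in 𝓝 ((0 : ℝ), x₀), ∀ t : TimeInterval,
        f p t = p.2 + p.1 • ∫ s in (0 : ℝ)..t, X (f p (TimeInterval.proj s)) := by
  let Xc : C(E, E) := ⟨X, hX.continuous⟩
  let S : C(TimeInterval, E) → C(TimeInterval, E) := fun γ ↦
    TimeInterval.primitive E (Xc.comp γ)
  have hS : ContDiff ℝ ∞ S :=
    (TimeInterval.primitive E).contDiff.comp (ContinuousMap.contDiff_comp Xc hX)
  let G : (ℝ × E) × C(TimeInterval, E) → (ℝ × E) × C(TimeInterval, E) := fun q ↦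
    (q.1, q.2 - (TimeInterval.constCurve E q.1.2 + q.1.1 • S q.2))
  have hG : ContDiff ℝ ∞ G := by
    have h1 : ContDiff ℝ ∞ fun q : (ℝ × E) × C(TimeInterval, E) ↦
        TimeInterval.constCurve E q.1.2 :=
      (TimeInterval.constCurve E).contDiff.comp (contDiff_snd.comp contDiff_fst)
    have h2 : ContDiff ℝ ∞ fun q : (ℝ × E) × C(TimeInterval, E) ↦ S q.2 := hS.comp contDiff_snd
    exact contDiff_fst.prodMk (contDiff_snd.sub
      (h1.add ((contDiff_fst.comp contDiff_fst).smul h2)))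
  let γ₀ : C(TimeInterval, E) := TimeInterval.constCurve E x₀
  let q₀ : (ℝ × E) × C(TimeInterval, E) := ((0, x₀), γ₀)
  let L : ℝ × E →L[ℝ] C(TimeInterval, E) :=
    -((TimeInterval.constCurve E).comp (ContinuousLinearMap.snd ℝ ℝ E) +
      (ContinuousLinearMap.fst ℝ ℝ E).smulRight (S γ₀))
  let A : ((ℝ × E) × C(TimeInterval, E)) ≃L[ℝ] ((ℝ × E) × C(TimeInterval, E)) :=
    ContinuousLinearEquiv.skewProd (.refl ℝ _) (.refl ℝ _) L
  have hA : HasFDerivAt G (A : _ →L[ℝ] _) q₀ := by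
    have hS' : HasFDerivAt (fun q : (ℝ × E) × C(TimeInterval, E) ↦ S q.2) _ q₀ :=
      ((hS.comp contDiff_snd).differentiable (by simp) q₀).hasFDerivAt
    have h1 : HasFDerivAt (fun q : (ℝ × E) × C(TimeInterval, E) ↦ q.1.1)
        ((ContinuousLinearMap.fst ℝ ℝ E).comp (ContinuousLinearMap.fst ℝ (ℝ × E) _)) q₀ :=
      ContinuousLinearMap.hasFDerivAt (E := (ℝ × E) × C(TimeInterval, E))
        ((ContinuousLinearMap.fst ℝ ℝ E).comp (ContinuousLinearMap.fst ℝ (ℝ × E) _))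
    have h2 : HasFDerivAt (fun q : (ℝ × E) × C(TimeInterval, E) ↦
        TimeInterval.constCurve E q.1.2)
        ((TimeInterval.constCurve E).comp
          ((ContinuousLinearMap.snd ℝ ℝ E).comp (ContinuousLinearMap.fst ℝ (ℝ × E) _))) q₀ :=
      ContinuousLinearMap.hasFDerivAt (E := (ℝ × E) × C(TimeInterval, E))
        ((TimeInterval.constCurve E).comp
          ((ContinuousLinearMap.snd ℝ ℝ E).comp (ContinuousLinearMap.fst ℝ (ℝ × E) _)))
    have h := (hasFDerivAt_fst (𝕜 := ℝ) (p := q₀)).prodMk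
      ((hasFDerivAt_snd (𝕜 := ℝ) (p := q₀)).sub (h2.add (h1.smul hS')))
    refine h.congr_fderiv ?_
    ext q <;> simp [A, L, q₀]
  have hGA := hG.contDiffAt (x := q₀)
  let g := hGA.localInverse hA (by simp)
  have hg : ContDiffAt ℝ ∞ g (G q₀) := hGA.to_localInverse hA (by simp)
  have hGq₀ : G q₀ = ((0, x₀), 0) := by simp [G, q₀, γ₀]
  rw [hGq₀] at hg
  have hgq₀ : g ((0, x₀), 0) = q₀ := by
    rw [← hGq₀]
    exact hGA.localInverse_apply_image hA (by simp)
  have hinv : ∀ᶠ y in 𝓝 (G q₀), G (g y) = y :=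
    (hGA.hasStrictFDerivAt' hA (by simp)).eventually_right_inverse
  rw [hGq₀] at hinv
  have hι : Continuous fun p : ℝ × E ↦ (p, (0 : C(TimeInterval, E))) := by fun_prop
  refine ⟨fun p ↦ (g (p, 0)).2, ?_, by simp [hgq₀, q₀, γ₀], ?_⟩
  · exact contDiffAt_snd.comp _ (ContDiffAt.comp (0, x₀) hg
      (contDiffAt_id.prodMk contDiffAt_const))
  · filter_upwards [hι.tendsto' (0, x₀) _ rfl |>.eventually hinv] with p hp t
    obtain ⟨hp1, hp2⟩ := Prod.ext_iff.1 hp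
    have hp1 : (g (p, 0)).1 = p := hp1
    have h := congrArg (fun γ : C(TimeInterval, E) ↦ γ t) (sub_eq_zero.1 hp2)
    simpa [hp1, S, Xc, TimeInterval.primitive_apply] using h

end SmoothDependence

/-! ### Vector fields in charts -/

section InChart

open Set Topology VectorField

variable {E M : Type*} [NormedAddCommGroup E] [NormedSpace ℝ E] [TopologicalSpace M]
  [ChartedSpace E M]

/-- The expression of a vector field in the preferred chart at `x₀`, a vector field on the model
vector space (meaningful on the target of the chart). -/
noncomputable def VectorField.inChart (X : ∀ x : M, TangentSpace 𝓘(ℝ, E) x) (x₀ : M) : E → E :=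
  mpullback 𝓘(ℝ, E) 𝓘(ℝ, E) (extChartAt 𝓘(ℝ, E) x₀).symm X

variable [IsManifold 𝓘(ℝ, E) ∞ M]

lemma contMDiffAt_extChartAt_symm {x₀ : M} {y : E} (hy : y ∈ (extChartAt 𝓘(ℝ, E) x₀).target) :
    ContMDiffAt 𝓘(ℝ, E) 𝓘(ℝ, E) ∞ (extChartAt 𝓘(ℝ, E) x₀).symm y :=
  (contMDiffOn_extChartAt_symm x₀).contMDiffAt ((isOpen_extChartAt_target x₀).mem_nhds hy)

lemma isInvertible_mfderiv_extChartAt_symm {x₀ : M} {y : E}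
    (hy : y ∈ (extChartAt 𝓘(ℝ, E) x₀).target) :
    (mfderiv 𝓘(ℝ, E) 𝓘(ℝ, E) (extChartAt 𝓘(ℝ, E) x₀).symm y).IsInvertible := by
  have : IsManifold 𝓘(ℝ, E) 1 M := .of_le (n := ∞) (by simp)
  have := isInvertible_mfderivWithin_extChartAt_symm (I := 𝓘(ℝ, E)) hy
  rwa [ModelWithCorners.range_eq_univ, mfderivWithin_univ] at this

lemma VectorField.mfderiv_symm_inChart (X : ∀ x : M, TangentSpace 𝓘(ℝ, E) x) {x₀ : M} {y : E}
    (hy : y ∈ (extChartAt 𝓘(ℝ, E) x₀).target) :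
    mfderiv 𝓘(ℝ, E) 𝓘(ℝ, E) (extChartAt 𝓘(ℝ, E) x₀).symm y (inChart (E := E) X x₀ y) =
      X ((extChartAt 𝓘(ℝ, E) x₀).symm y) :=
  (isInvertible_mfderiv_extChartAt_symm hy).self_apply_inverse _

lemma VectorField.contDiffOn_inChart [CompleteSpace E] {X : ∀ x : M, TangentSpace 𝓘(ℝ, E) x}
    (hX : ContMDiff 𝓘(ℝ, E) 𝓘(ℝ, E).tangent ∞
      (fun x ↦ (⟨x, X x⟩ : TangentBundle 𝓘(ℝ, E) M))) (x₀ : M) :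
    ContDiffOn ℝ ∞ (inChart X x₀) (extChartAt 𝓘(ℝ, E) x₀).target := by
  refine contMDiffOn_vectorSpace_iff_contDiffOn.1 fun y hy ↦ ?_
  exact (ContMDiffAt.mpullback_vectorField_preimage (n := ∞) (hX _)
    (contMDiffAt_extChartAt_symm hy) (isInvertible_mfderiv_extChartAt_symm hy)
    (by simp)).contMDiffWithinAt

/-- An integral curve in a chart is an integral curve on the manifold. -/
lemma VectorField.hasMFDerivAt_symm_comp {X : ∀ x : M, TangentSpace 𝓘(ℝ, E) x} {x₀ : M}
    {c : ℝ → E} {τ t : ℝ} (hc : HasDerivAt c (τ • inChart X x₀ (c t)) t)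
    (ht : c t ∈ (extChartAt 𝓘(ℝ, E) x₀).target) :
    HasMFDerivAt 𝓘(ℝ, ℝ) 𝓘(ℝ, E) (fun s ↦ (extChartAt 𝓘(ℝ, E) x₀).symm (c s)) t
      ((1 : ℝ →L[ℝ] ℝ).smulRight ((τ • X) ((extChartAt 𝓘(ℝ, E) x₀).symm (c t)))) := by
  have h1 := ((contMDiffAt_extChartAt_symm ht).mdifferentiableAt (by simp)).hasMFDerivAt
  have h := h1.comp t hc.hasFDerivAt.hasMFDerivAt
  refine h.congr_mfderiv (ContinuousLinearMap.ext_ring ?_)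
  change mfderiv 𝓘(ℝ, E) 𝓘(ℝ, E) (extChartAt 𝓘(ℝ, E) x₀).symm (c t)
    ((1 : ℝ) • τ • inChart (E := E) X x₀ (c t)) =
      (1 : ℝ) • τ • X ((extChartAt 𝓘(ℝ, E) x₀).symm (c t))
  rw [one_smul, one_smul]
  exact (ContinuousLinearMap.map_smul _ _ _).trans
    (congrArg (τ • ·) (mfderiv_symm_inChart X ht))

end InChart

/-! ### Flows of complete vector fields are smooth -/

section Flow

open Set Topology VectorField

variable {E M : Type*} [NormedAddCommGroup E] [NormedSpace ℝ E] [TopologicalSpace M]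
  [ChartedSpace E M]

/-- `φ` is the (global) flow of the vector field `X`: `t ↦ φ t x` is the integral curve of `X`
through `x`. -/
structure IsFlow (X : ∀ x : M, TangentSpace 𝓘(ℝ, E) x) (φ : ℝ → M → M) : Prop where
  map_zero : ∀ x, φ 0 x = x
  isMIntegralCurve : ∀ x, IsMIntegralCurve (I := 𝓘(ℝ, E)) (fun t ↦ φ t x) X

namespace IsFlow

variable [IsManifold 𝓘(ℝ, E) ∞ M] [T2Space M]
  {X : ∀ x : M, TangentSpace 𝓘(ℝ, E) x} {φ : ℝ → M → M}

lemma eq_of_isMIntegralCurve [CompleteSpace E] (hφ : IsFlow X φ)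
    (hX : ContMDiff 𝓘(ℝ, E) 𝓘(ℝ, E).tangent ∞
      (fun x ↦ (⟨x, X x⟩ : TangentBundle 𝓘(ℝ, E) M)))
    {γ : ℝ → M} (hγ : IsMIntegralCurve (I := 𝓘(ℝ, E)) γ X) (t : ℝ) :
    γ t = φ t (γ 0) := by
  have : IsManifold 𝓘(ℝ, E) 1 M := .of_le (n := ∞) (by simp)
  exact congrFun (isMIntegralCurve_Ioo_eq_of_contMDiff_boundaryless (t₀ := 0) (hX.of_le (by simp))
    hγ (hφ.isMIntegralCurve (γ 0)) (hφ.map_zero _).symm) t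

lemma map_add [CompleteSpace E] (hφ : IsFlow X φ) (hX : ContMDiff 𝓘(ℝ, E) 𝓘(ℝ, E).tangent ∞
      (fun x ↦ (⟨x, X x⟩ : TangentBundle 𝓘(ℝ, E) M))) (s t : ℝ) (x : M) :
    φ (s + t) x = φ s (φ t x) := by
  have := hφ.eq_of_isMIntegralCurve hX ((hφ.isMIntegralCurve x).comp_add t) s
  simpa using this

/-- Near the initial time the flow is given, in a chart, by the smooth solution of the integral
equation. -/
lemma contMDiffAt_zero [FiniteDimensional ℝ E] (hφ : IsFlow X φ)
    (hX : ContMDiff 𝓘(ℝ, E) 𝓘(ℝ, E).tangent ∞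
      (fun x ↦ (⟨x, X x⟩ : TangentBundle 𝓘(ℝ, E) M))) (x₀ : M) :
    ContMDiffAt (𝓘(ℝ, ℝ).prod 𝓘(ℝ, E)) 𝓘(ℝ, E) ∞ (fun p : ℝ × M ↦ φ p.1 p.2) (0, x₀) := by
  have : IsManifold 𝓘(ℝ, E) 1 M := .of_le (n := ∞) (by simp)
  have : CompleteSpace E := FiniteDimensional.complete ℝ E
  set e := extChartAt 𝓘(ℝ, E) x₀ with he
  set y₀ := e x₀ with hy₀
  have hopen : IsOpen e.target := isOpen_extChartAt_target x₀
  have hy₀t : y₀ ∈ e.target := mem_extChartAt_target x₀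
  -- cut the vector field off outside a neighbourhood of the centre of the chart
  obtain ⟨χ, hχt⟩ : ∃ χ : ContDiffBump y₀, tsupport χ ⊆ e.target := by
    obtain ⟨r, hr, hball⟩ := Metric.nhds_basis_closedBall.mem_iff.1 (hopen.mem_nhds hy₀t)
    exact ⟨⟨r / 2, r, by positivity, by linarith⟩,
      by rwa [ContDiffBump.tsupport_eq]⟩
  set Y : E → E := fun y ↦ χ y • inChart X x₀ y with hYdef
  have hXe := contDiffOn_inChart hX x₀
  have hY : ContDiff ℝ ∞ Y := by
    rw [contDiff_iff_contDiffAt]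
    intro y
    by_cases hy : y ∈ tsupport χ
    · exact χ.contDiff.contDiffAt.smul (hXe.contDiffAt (hopen.mem_nhds (hχt hy)))
    · have h0 : Y =ᶠ[𝓝 y] fun _ ↦ 0 := by
        filter_upwards [(isClosed_tsupport χ).isOpen_compl.mem_nhds hy] with z hz
        simp [hYdef, image_eq_zero_of_notMem_tsupport hz]
      exact contDiffAt_const.congr_of_eventuallyEq h0
  obtain ⟨f, hf, hf0, hfe⟩ := exists_contDiffAt_solution hY y₀
  have hδ : ∀ᶠ p in 𝓝 ((0 : ℝ), y₀), dist (f p) (TimeInterval.constCurve E y₀) < χ.rIn := by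
    have := hf.continuousAt
    rw [ContinuousAt, hf0] at this
    exact this.eventually (Metric.ball_mem_nhds _ χ.rIn_pos)
  -- the curve found in the chart is the integral curve on the manifold
  have key : ∀ᶠ p in 𝓝 ((0 : ℝ), y₀), φ p.1 (e.symm p.2) = e.symm (f p (TimeInterval.proj 1)) := by
    filter_upwards [hfe, hδ] with p hp hpδ
    let c : ℝ → E := fun t ↦ p.2 + p.1 • ∫ s in (0 : ℝ)..t, Y (f p (TimeInterval.proj s))
    have hproj : ∀ t ∈ Ioo (-2 : ℝ) 2, (TimeInterval.proj t : ℝ) = t := fun t ht ↦ by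
      simp [TimeInterval.proj, projIcc_of_mem _ (Ioo_subset_Icc_self ht)]
    have hcf : ∀ t ∈ Ioo (-2 : ℝ) 2, f p (TimeInterval.proj t) = c t := fun t ht ↦ by
      rw [hp, hproj t ht]
    have hmem : ∀ t ∈ Ioo (-2 : ℝ) 2, c t ∈ Metric.closedBall y₀ χ.rIn := fun t ht ↦ by
      rw [← hcf t ht]
      exact (ContinuousMap.dist_apply_le_dist _).trans hpδ.le
    have hmemt : ∀ t ∈ Ioo (-2 : ℝ) 2, c t ∈ e.target := fun t ht ↦
      hχt (χ.tsupport_eq ▸ Metric.closedBall_subset_closedBall χ.rIn_lt_rOut.le (hmem t ht))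
    have hcont : Continuous fun s ↦ Y (f p (TimeInterval.proj s)) :=
      hY.continuous.comp ((f p).continuous.comp TimeInterval.continuous_proj)
    have hder : ∀ t ∈ Ioo (-2 : ℝ) 2, HasDerivAt c (p.1 • inChart X x₀ (c t)) t := fun t ht ↦ by
      have h : HasDerivAt c (p.1 • Y (f p (TimeInterval.proj t))) t :=
        ((hcont.integral_hasStrictDerivAt 0 t).hasDerivAt.const_smul p.1).const_add p.2
      have hχ : χ (c t) = 1 := χ.one_of_mem_closedBall (hmem t ht)
      have hYc : Y (c t) = inChart X x₀ (c t) := by rw [hYdef]; simp only [hχ, one_smul]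
      rwa [hcf t ht, hYc] at h
    have h1 : IsMIntegralCurveOn (I := 𝓘(ℝ, E)) (fun t ↦ e.symm (c t)) (p.1 • X) (Ioo (-2) 2) :=
      fun t ht ↦ (hasMFDerivAt_symm_comp (hder t ht) (hmemt t ht)).hasMFDerivWithinAt
    have h2 : IsMIntegralCurveOn (I := 𝓘(ℝ, E)) (fun t ↦ φ (t * p.1) (e.symm p.2)) (p.1 • X)
        (Ioo (-2) 2) :=
      ((hφ.isMIntegralCurve (e.symm p.2)).comp_mul p.1).isMIntegralCurveOn _
    have hXs : ContMDiff 𝓘(ℝ, E) 𝓘(ℝ, E).tangent 1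
        (fun x ↦ (⟨x, (p.1 • X) x⟩ : TangentBundle 𝓘(ℝ, E) M)) :=
      (hX.of_le (by simp)).const_smul_section
    have h := isMIntegralCurveOn_Ioo_eqOn_of_contMDiff_boundaryless (t₀ := 0) (by norm_num) hXs
      h2 h1 (by simp [c, hφ.map_zero])
    have h1mem : (1 : ℝ) ∈ Ioo (-2 : ℝ) 2 := by norm_num
    have := h h1mem
    simpa [hcf 1 h1mem] using this
  have hev : ContMDiffAt 𝓘(ℝ, ℝ × E) 𝓘(ℝ, E) ∞ (fun p ↦ f p (TimeInterval.proj 1)) (0, y₀) := by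
    have : ContDiffAt ℝ ∞ (fun p ↦ f p (TimeInterval.proj 1)) (0, y₀) :=
      (ContinuousLinearMap.contDiff (E := C(TimeInterval, E))
        (ContinuousMap.evalCLM ℝ (TimeInterval.proj 1))).contDiffAt.comp _ hf
    exact this.contMDiffAt
  have hF : ContMDiffAt 𝓘(ℝ, ℝ × E) 𝓘(ℝ, E) ∞
      (fun p : ℝ × E ↦ e.symm (f p (TimeInterval.proj 1))) (0, y₀) := by
    refine ContMDiffAt.comp (0, y₀) (I' := 𝓘(ℝ, E)) (g := e.symm) ?_ hev
    rw [hf0]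
    exact contMDiffAt_extChartAt_symm hy₀t
  have hι : ContMDiffAt (𝓘(ℝ, ℝ).prod 𝓘(ℝ, E)) 𝓘(ℝ, ℝ × E) ∞ (fun p : ℝ × M ↦ (p.1, e p.2))
      (0, x₀) := by
    have h1 : ContMDiffAt (𝓘(ℝ, ℝ).prod 𝓘(ℝ, E)) 𝓘(ℝ, E) ∞ (fun p : ℝ × M ↦ e p.2) (0, x₀) :=
      ContMDiffAt.comp (0, x₀) (I' := 𝓘(ℝ, E)) (g := e) contMDiffAt_extChartAt contMDiffAt_snd
    exact contMDiffAt_fst.prodMk_space h1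
  have hcomp := ContMDiffAt.comp (0, x₀) hF hι
  refine hcomp.congr_of_eventuallyEq ?_
  have hsrc : ∀ᶠ p : ℝ × M in 𝓝 (0, x₀), p.2 ∈ e.source :=
    continuousAt_snd.eventually (extChartAt_source_mem_nhds x₀)
  filter_upwards [hι.continuousAt.eventually key, hsrc] with p hp hps
  simpa [e.left_inv hps] using hp

/-- The flow of a complete smooth vector field is smooth: along a compact piece of an integral
curve it is smooth for a uniform short time, and `φ t` is the `m`-th iterate of `φ (t / m)`. -/
theorem contMDiff [FiniteDimensional ℝ E] (hφ : IsFlow X φ)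
    (hX : ContMDiff 𝓘(ℝ, E) 𝓘(ℝ, E).tangent ∞
      (fun x ↦ (⟨x, X x⟩ : TangentBundle 𝓘(ℝ, E) M))) :
    ContMDiff (𝓘(ℝ, ℝ).prod 𝓘(ℝ, E)) 𝓘(ℝ, E) ∞ (fun p : ℝ × M ↦ φ p.1 p.2) := by
  have : CompleteSpace E := FiniteDimensional.complete ℝ E
  rw [contMDiff_infty]
  rintro n ⟨t₀, x₀⟩
  have : IsManifold 𝓘(ℝ, E) n M := .of_le (n := ∞) (mod_cast le_top)
  -- for finite `n` the set of points of `C^n` smoothness is open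
  set U : Set (ℝ × M) :=
    {p | ContMDiffAt (𝓘(ℝ, ℝ).prod 𝓘(ℝ, E)) 𝓘(ℝ, E) n (fun p : ℝ × M ↦ φ p.1 p.2) p} with hU
  have hUo : IsOpen U := isOpen_iff_mem_nhds.2 fun p hp ↦
    (contMDiffAt_iff_contMDiffAt_nhds (by simp)).1 hp
  set K : Set M := (fun t ↦ φ t x₀) '' Icc (-|t₀|) |t₀| with hK
  have hKc : IsCompact K := isCompact_Icc.image (hφ.isMIntegralCurve x₀).continuous
  have hsub : ({0} : Set ℝ) ×ˢ K ⊆ U := by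
    rintro ⟨t, x⟩ ⟨rfl, -⟩
    exact (hφ.contMDiffAt_zero hX x).of_le (mod_cast le_top)
  obtain ⟨u, v, huo, -, hu, hv, huv⟩ := generalized_tube_lemma isCompact_singleton hKc hUo hsub
  have hlim : Filter.Tendsto (fun m : ℕ ↦ t₀ / (m : ℝ)) Filter.atTop (𝓝 0) :=
    tendsto_const_div_atTop_nhds_zero_nat t₀
  obtain ⟨m, hmu, hm⟩ := ((hlim.eventually (huo.mem_nhds (hu rfl))).and
    (Filter.eventually_gt_atTop 0)).exists
  have hm0 : (0 : ℝ) < m := by exact_mod_cast hm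
  have hstep : ∀ i : ℕ, i ≤ m → ContMDiffAt (𝓘(ℝ, ℝ).prod 𝓘(ℝ, E)) 𝓘(ℝ, E) n
      (fun p : ℝ × M ↦ φ (i * (p.1 / m)) p.2) (t₀, x₀) := by
    intro i
    induction i with
    | zero =>
      intro _
      have h : ContMDiffAt (𝓘(ℝ, ℝ).prod 𝓘(ℝ, E)) 𝓘(ℝ, E) n (fun p : ℝ × M ↦ p.2) (t₀, x₀) :=
        contMDiffAt_snd
      simpa [hφ.map_zero] using h
    | succ i ih =>
      intro hi
      have ih := ih (by omega)
      have hmem : (t₀ / m, φ (i * (t₀ / m)) x₀) ∈ U := by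
        refine huv ⟨hmu, hv ⟨i * (t₀ / m), abs_le.1 ?_, rfl⟩⟩
        rw [abs_mul, abs_div, abs_of_pos hm0, Nat.abs_cast, mul_div_left_comm]
        refine mul_le_of_le_one_right (abs_nonneg _) ((div_le_one hm0).2 ?_)
        exact_mod_cast (by omega : i ≤ m)
      have h1 : ContMDiffAt (𝓘(ℝ, ℝ).prod 𝓘(ℝ, E)) 𝓘(ℝ, ℝ) n
          (fun p : ℝ × M ↦ p.1 / (m : ℝ)) (t₀, x₀) := by
        have h0 : ContMDiff 𝓘(ℝ, ℝ) 𝓘(ℝ, ℝ) n fun t : ℝ ↦ t / (m : ℝ) :=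
          (contDiff_id.div_const _).contMDiff
        exact ContMDiffAt.comp (t₀, x₀) (g := fun t : ℝ ↦ t / (m : ℝ)) (h0 t₀)
          (contMDiffAt_fst (I := 𝓘(ℝ, ℝ)) (J := 𝓘(ℝ, E)))
      have h := ContMDiffAt.comp (t₀, x₀) (g := fun p : ℝ × M ↦ φ p.1 p.2)
        (f := fun p : ℝ × M ↦ (p.1 / (m : ℝ), φ (i * (p.1 / m)) p.2)) hmem (h1.prodMk ih)
      refine h.congr_of_eventuallyEq (Filter.Eventually.of_forall fun p ↦ ?_)
      simp only [Function.comp_apply]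
      rw [← hφ.map_add hX]
      push_cast
      ring_nf
  have h := hstep m le_rfl
  simpa [mul_div_cancel₀ _ hm0.ne'] using h

end IsFlow

end Flow

/-! ### Embedded submanifolds from slice charts -/

section SliceChart

universe u

open Set Topology

variable {E M F : Type*} [NormedAddCommGroup E] [NormedSpace ℝ E] [TopologicalSpace M]
  [ChartedSpace E M] [NormedAddCommGroup F] [NormedSpace ℝ F]

variable (E F) in
/-- A slice chart of dimension `k` for the subset `N` of `M` around `x`: a smooth chart of `M`
which maps `N` onto the points with vanishing second coordinate, with respect to some splitting
`ℝᵏ × F ≃ E` of the model space. -/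
structure SliceChart (N : Set M) (k : ℕ) (x : M) where
  /-- the chart of the ambient manifold -/
  chart : OpenPartialHomeomorph M E
  mem_maximalAtlas : chart ∈ IsManifold.maximalAtlas 𝓘(ℝ, E) ∞ M
  mem_source : x ∈ chart.source
  /-- the splitting of the model space -/
  equiv : (EuclideanSpace ℝ (Fin k) × F) ≃L[ℝ] E
  mem_iff : ∀ y ∈ chart.source, y ∈ N ↔ (equiv.symm (chart y)).2 = 0

namespace SliceChart

variable {N : Set M} {k : ℕ} {x : N}

lemma symm_mem (S : SliceChart E F N k x) {z : EuclideanSpace ℝ (Fin k)}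
    (hz : S.equiv (z, 0) ∈ S.chart.target) : S.chart.symm (S.equiv (z, 0)) ∈ N := by
  rw [S.mem_iff _ (S.chart.map_target hz), S.chart.right_inv hz]
  simp

lemma equiv_fst (S : SliceChart E F N k x) {n : N} (hn : (n : M) ∈ S.chart.source) :
    S.equiv ((S.equiv.symm (S.chart n)).1, 0) = S.chart n := by
  rw [← (S.mem_iff _ hn).1 n.2, Prod.mk.eta, ContinuousLinearEquiv.apply_symm_apply]

open Classical in
/-- The chart of `N` induced by a slice chart. Outside of its target the inverse takes the
irrelevant value `x`. -/
noncomputable def restrict (S : SliceChart E F N k x) :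
    OpenPartialHomeomorph N (EuclideanSpace ℝ (Fin k)) where
  toFun n := (S.equiv.symm (S.chart n)).1
  invFun z := if h : S.chart.symm (S.equiv (z, 0)) ∈ N then ⟨_, h⟩ else x
  source := Subtype.val ⁻¹' S.chart.source
  target := (fun z ↦ S.equiv (z, 0)) ⁻¹' S.chart.target
  map_source' n hn := by
    rw [mem_preimage, S.equiv_fst hn]
    exact S.chart.map_source hn
  map_target' z hz := by
    rw [mem_preimage, dif_pos (S.symm_mem hz)]
    exact S.chart.map_target hz
  left_inv' n hn := by
    have h : S.chart.symm (S.equiv ((S.equiv.symm (S.chart n)).1, 0)) = n := by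
      rw [S.equiv_fst hn, S.chart.left_inv hn]
    rw [dif_pos (by rw [h]; exact n.2)]
    exact Subtype.ext h
  right_inv' z hz := by
    rw [dif_pos (S.symm_mem hz), S.chart.right_inv hz]
    simp
  open_source := S.chart.open_source.preimage continuous_subtype_val
  open_target := S.chart.open_target.preimage (by fun_prop)
  continuousOn_toFun := by
    have h : ContinuousOn (fun n : N ↦ S.chart n) (Subtype.val ⁻¹' S.chart.source) :=
      S.chart.continuousOn.comp continuous_subtype_val.continuousOn fun _ h ↦ h
    exact (continuous_fst.comp S.equiv.symm.continuous).comp_continuousOn h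
  continuousOn_invFun := by
    rw [IsEmbedding.subtypeVal.continuousOn_iff]
    have h : ContinuousOn (fun z ↦ S.chart.symm (S.equiv (z, 0)))
        ((fun z ↦ S.equiv (z, 0)) ⁻¹' S.chart.target) :=
      S.chart.continuousOn_symm.comp (by fun_prop) fun _ h ↦ h
    exact h.congr fun z hz ↦ by simp [S.symm_mem hz]

lemma coe_restrict_symm (S : SliceChart E F N k x) {z : EuclideanSpace ℝ (Fin k)}
    (hz : z ∈ S.restrict.target) :
    (S.restrict.symm z : M) = S.chart.symm (S.equiv (z, 0)) := by
  have h : S.restrict.symm z = ⟨_, S.symm_mem hz⟩ := dif_pos (S.symm_mem hz)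
  rw [h]

lemma contMDiffOn_coe_restrict_symm (S : SliceChart E F N k x) :
    ContMDiffOn (𝓡 k) 𝓘(ℝ, E) ∞ (fun z ↦ (S.restrict.symm z : M)) S.restrict.target := by
  have h1 : ContMDiff (𝓡 k) 𝓘(ℝ, E) ∞ fun z ↦ S.equiv (z, 0) :=
    (S.equiv.contDiff.comp (contDiff_id.prodMk contDiff_const)).contMDiff
  exact ((contMDiffOn_symm_of_mem_maximalAtlas S.mem_maximalAtlas).comp h1.contMDiffOn
    fun _ h ↦ h).congr fun z hz ↦ S.coe_restrict_symm hz

/-- The projection of the ambient slice chart which induces the chart of `N` is smooth. -/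
lemma contMDiffOn_fst_chart (S : SliceChart E F N k x) :
    ContMDiffOn 𝓘(ℝ, E) (𝓡 k) ∞ (fun y ↦ (S.equiv.symm (S.chart y)).1) S.chart.source := by
  have h1 : ContMDiff 𝓘(ℝ, E) (𝓡 k) ∞ fun y ↦ (S.equiv.symm y).1 :=
    (contDiff_fst.comp S.equiv.symm.contDiff).contMDiff
  exact h1.comp_contMDiffOn (contMDiffOn_of_mem_maximalAtlas S.mem_maximalAtlas)

/-- The manifold structure on a subset with slice charts. -/
noncomputable abbrev chartedSpace (S : ∀ x : N, SliceChart E F N k x) :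
    ChartedSpace (EuclideanSpace ℝ (Fin k)) N where
  atlas := range fun x ↦ (S x).restrict
  chartAt x := (S x).restrict
  mem_chart_source x := (S x).mem_source
  chart_mem_atlas x := mem_range_self x

lemma isManifold (S : ∀ x : N, SliceChart E F N k x) :
    @IsManifold ℝ _ _ _ _ _ _ (𝓡 k) ∞ N _ (chartedSpace S) := by
  let := chartedSpace S
  refine isManifold_of_contDiffOn _ _ _ ?_
  rintro _ _ ⟨x, rfl⟩ ⟨x', rfl⟩
  rw [← contMDiffOn_iff_contDiffOn]
  refine ((S x').contMDiffOn_fst_chart.comp ((S x).contMDiffOn_coe_restrict_symm.mono ?_)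
    ?_).congr ?_
  · exact fun z hz ↦ hz.1.1
  · exact fun z hz ↦ hz.1.2
  · exact fun z hz ↦ rfl

lemma contMDiff_of_coe (S : ∀ x : N, SliceChart E F N k x) {E' H' P : Type*} [NormedAddCommGroup E']
    [NormedSpace ℝ E'] [TopologicalSpace H'] {I' : ModelWithCorners ℝ E' H'} [TopologicalSpace P]
    [ChartedSpace H' P] {f : P → N} (hf : ContMDiff I' 𝓘(ℝ, E) ∞ (fun p ↦ (f p : M))) :
    letI := chartedSpace S
    ContMDiff I' (𝓡 k) ∞ f := by
  let := chartedSpace S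
  have hc : Continuous f := IsEmbedding.subtypeVal.continuous_iff.2 hf.continuous
  intro p
  rw [contMDiffAt_iff_target]
  refine ⟨hc.continuousAt, ?_⟩
  have h1 := (S (f p)).contMDiffOn_fst_chart.contMDiffAt
    ((S (f p)).chart.open_source.mem_nhds (S (f p)).mem_source)
  exact ContMDiffAt.comp p (f := fun p ↦ (f p : M)) h1 (hf p)

lemma isSmoothEmbedding {E F : Type u} [NormedAddCommGroup E] [NormedSpace ℝ E]
    [NormedAddCommGroup F] [NormedSpace ℝ F] [ChartedSpace E M]
    (S : ∀ x : N, SliceChart E F N k x) :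
    letI := chartedSpace S
    Manifold.IsSmoothEmbedding (𝓡 k) 𝓘(ℝ, E) ∞ (Subtype.val : N → M) := by
  let := chartedSpace S
  have := isManifold S
  refine ⟨⟨F, inferInstance, inferInstance, fun x ↦ ?_⟩, IsEmbedding.subtypeVal⟩
  refine Manifold.IsImmersionAtOfComplement.mk_of_continuousAt continuous_subtype_val.continuousAt
    (S x).equiv (S x).restrict (S x).chart (S x).mem_source (S x).mem_source
    (IsManifold.chart_mem_maximalAtlas x) (S x).mem_maximalAtlas ?_
  intro z hz
  have hz : z ∈ (S x).restrict.target := hz.2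
  have h := (S x).coe_restrict_symm hz
  change (S x).chart ((S x).restrict.symm z) = _
  rw [h, (S x).chart.right_inv hz]
  rfl

/-- The regular level set theorem, in the form of a slice chart. If `D` is the derivative at the
centre `y₀` of a chart of the expression `g` of `h` in that chart, and `s` is a right inverse of
`D`, then `y ↦ y + s (g y - D y)` is tangent to the identity at `y₀` and straightens the level set
into the kernel of `D`. -/
theorem exists_of_regular [FiniteDimensional ℝ E] [IsManifold 𝓘(ℝ, E) ∞ M] {V : Type*}
    [NormedAddCommGroup V] [NormedSpace ℝ V] [FiniteDimensional ℝ V] {h : M → V}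
    (hh : ContMDiff 𝓘(ℝ, E) 𝓘(ℝ, V) ∞ h) {x₀ : M}
    (hs : Function.Surjective (mfderiv 𝓘(ℝ, E) 𝓘(ℝ, V) h x₀)) (L : F ≃L[ℝ] V) {k : ℕ}
    (hk : k + Module.finrank ℝ V = Module.finrank ℝ E) :
    Nonempty (SliceChart E F {x | h x = 0} k x₀) := by
  have : CompleteSpace E := FiniteDimensional.complete ℝ E
  set e := chartAt E x₀ with he
  have heM : e ∈ IsManifold.maximalAtlas 𝓘(ℝ, E) ∞ M := IsManifold.chart_mem_maximalAtlas x₀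
  have hx₀ : x₀ ∈ e.source := mem_chart_source E x₀
  set y₀ := e x₀ with hy₀
  have hy₀t : y₀ ∈ e.target := e.map_source hx₀
  set g : E → V := fun y ↦ h (e.symm y) with hg_def
  have hg : ContDiffOn ℝ ∞ g e.target := by
    rw [← contMDiffOn_iff_contDiffOn]
    exact hh.comp_contMDiffOn (contMDiffOn_symm_of_mem_maximalAtlas heM)
  have hgy₀ : ContDiffAt ℝ ∞ g y₀ := hg.contDiffAt (e.open_target.mem_nhds hy₀t)
  set D : E →L[ℝ] V := fderiv ℝ g y₀ with hD
  have hgD : HasFDerivAt g D y₀ := (hgy₀.differentiableAt (by simp)).hasFDerivAt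
  have hDs : Function.Surjective D := by
    intro v
    obtain ⟨a, ha⟩ := hs v
    have h1 : MDifferentiableAt 𝓘(ℝ, E) 𝓘(ℝ, E) e x₀ :=
      (contMDiffAt_of_mem_maximalAtlas heM hx₀).mdifferentiableAt (by simp)
    have h2 := (hgD.hasMFDerivAt).comp x₀ h1.hasMFDerivAt
    have h3 : h =ᶠ[𝓝 x₀] g ∘ e := by
      filter_upwards [e.open_source.mem_nhds hx₀] with x hx
      simp [hg_def, e.left_inv hx]
    have h4 := (h2.congr_of_eventuallyEq h3).mfderiv
    refine ⟨mfderiv 𝓘(ℝ, E) 𝓘(ℝ, E) e x₀ a, ?_⟩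
    rw [h4] at ha
    exact ha
  obtain ⟨s, hDs'⟩ : ∃ s : V →L[ℝ] E, D ∘L s = .id ℝ V := by
    obtain ⟨s, hs⟩ := D.toLinearMap.exists_rightInverse_of_surjective
      (LinearMap.range_eq_top.2 hDs)
    exact ⟨s.toContinuousLinearMap, ContinuousLinearMap.ext fun v ↦ LinearMap.congr_fun hs v⟩
  have hDsv : ∀ v, D (s v) = v := fun v ↦ DFunLike.congr_fun hDs' v
  -- the straightening map
  set G : E → E := fun y ↦ y + s (g y - D y) with hG_def
  have hDG : ∀ y, D (G y) = g y := fun y ↦ by simp [hG_def, hDsv]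
  have hG : ContDiffOn ℝ ∞ G e.target :=
    contDiffOn_id.add (s.contDiff.comp_contDiffOn (hg.sub D.contDiff.contDiffOn))
  have hGat : ∀ y ∈ e.target, ContDiffAt ℝ ∞ G y := fun y hy ↦
    hG.contDiffAt (e.open_target.mem_nhds hy)
  have hGd : HasFDerivAt G (ContinuousLinearEquiv.refl ℝ E : E →L[ℝ] E) y₀ := by
    have h1 := (hasFDerivAt_id y₀).add (s.hasFDerivAt.comp y₀ (hgD.sub D.hasFDerivAt))
    refine h1.congr_fderiv ?_
    ext v
    simp
  let Θ := (hGat y₀ hy₀t).toOpenPartialHomeomorph G hGd (by simp)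
  have hΘ : ∀ y, Θ y = G y := fun y ↦ rfl
  -- shrink the domain so that the derivative stays invertible
  set U : Set E := e.target ∩ (fderiv ℝ G) ⁻¹' range ((↑) : (E ≃L[ℝ] E) → E →L[ℝ] E) with hU
  have hUo : IsOpen U :=
    (hG.continuousOn_fderiv_of_isOpen e.open_target (by simp)).isOpen_inter_preimage
    e.open_target ContinuousLinearEquiv.isOpen
  let Θ' := Θ.restrOpen U hUo
  have hΘ'M : Θ' ∈ IsManifold.maximalAtlas 𝓘(ℝ, E) ∞ E := by
    refine OpenPartialHomeomorph.mem_maximalAtlas_of_contMDiffOn _ ?_ ?_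
    · exact (contMDiffOn_iff_contDiffOn.2 hG).mono fun y hy ↦ hy.2.1
    · intro z hz
      have hzU : Θ'.symm z ∈ U := (Θ'.map_target hz).2
      obtain ⟨A, hA⟩ := hzU.2
      have h1 := hGat _ hzU.1
      have h2 : HasFDerivAt Θ' (A : E →L[ℝ] E) (Θ'.symm z) := by
        rw [hA]
        exact (h1.differentiableAt (by simp)).hasFDerivAt
      exact (Θ'.contDiffAt_symm hz h2 h1).contMDiffAt.contMDiffWithinAt
  have hker : Module.finrank ℝ D.ker = k := by
    have h1 := D.toLinearMap.finrank_range_add_finrank_ker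
    rw [LinearMap.range_eq_top.2 hDs, finrank_top] at h1
    change _ + Module.finrank ℝ D.ker = _ at h1
    omega
  let κ : EuclideanSpace ℝ (Fin k) ≃L[ℝ] D.ker :=
    ContinuousLinearEquiv.ofFinrankEq (by rw [hker, finrank_euclideanSpace_fin])
  let A : E ≃L[ℝ] V × D.ker := ContinuousLinearEquiv.equivOfRightInverse D s hDsv
  let B : (EuclideanSpace ℝ (Fin k) × F) ≃L[ℝ] E :=
    ((κ.prodCongr L).trans (ContinuousLinearEquiv.prodComm ℝ _ _)).trans A.symm
  have hB : ∀ y, (B.symm y).2 = L.symm (D y) := fun y ↦ rfl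
  refine ⟨⟨e.trans Θ', ?_, ?_, B, ?_⟩⟩
  · refine OpenPartialHomeomorph.mem_maximalAtlas_of_contMDiffOn _ ?_ ?_
    · exact (contMDiffOn_of_mem_maximalAtlas hΘ'M).comp
        ((contMDiffOn_of_mem_maximalAtlas heM).mono fun x hx ↦ hx.1) fun x hx ↦ hx.2
    · exact (contMDiffOn_symm_of_mem_maximalAtlas heM).comp
        ((contMDiffOn_symm_of_mem_maximalAtlas hΘ'M).mono fun x hx ↦ hx.1) fun x hx ↦ hx.2
  · refine ⟨hx₀, (hGat y₀ hy₀t).mem_toOpenPartialHomeomorph_source hGd (by simp), hy₀t, ?_⟩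
    exact ⟨_, hGd.fderiv.symm⟩
  · intro y hy
    have h1 : D ((e.trans Θ') y) = h y := by
      change D (G (e y)) = h y
      rw [hDG, hg_def]
      simp only [e.left_inv hy.1]
    rw [hB, h1]
    simp

end SliceChart

end SliceChart

section RegularLevelSet

universe u

/-- The zero level of a map which is submersive there is an embedded submanifold, and maps into it
are smooth if they are smooth as maps to the ambient manifold. -/
theorem exists_isManifold_of_regular {E : Type u} [NormedAddCommGroup E] [NormedSpace ℝ E]
    [FiniteDimensional ℝ E] {M : Type*} [TopologicalSpace M] [ChartedSpace E M]
    [IsManifold 𝓘(ℝ, E) ∞ M] {V : Type*} [NormedAddCommGroup V] [NormedSpace ℝ V]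
    [FiniteDimensional ℝ V] {h : M → V} (hh : ContMDiff 𝓘(ℝ, E) 𝓘(ℝ, V) ∞ h) {N : Set M}
    (hN : ∀ x, x ∈ N ↔ h x = 0)
    (hs : ∀ x ∈ N, Function.Surjective (mfderiv 𝓘(ℝ, E) 𝓘(ℝ, V) h x)) :
    ∃ (k : ℕ) (_ : ChartedSpace (EuclideanSpace ℝ (Fin k)) N) (_ : IsManifold (𝓡 k) ∞ N),
      Manifold.IsSmoothEmbedding (𝓡 k) 𝓘(ℝ, E) ∞ (Subtype.val : N → M) ∧
      ∀ f : M → N, ContMDiff 𝓘(ℝ, E) 𝓘(ℝ, E) ∞ (fun x ↦ (f x : M)) →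
        ContMDiff 𝓘(ℝ, E) (𝓡 k) ∞ f := by
  obtain rfl : N = {x | h x = 0} := Set.ext hN
  -- the normal directions, as a vector space in the universe of `E`
  let L : ULift.{u} (EuclideanSpace ℝ (Fin (Module.finrank ℝ V))) ≃L[ℝ] V :=
    ContinuousLinearEquiv.ulift.trans
      (ContinuousLinearEquiv.ofFinrankEq finrank_euclideanSpace_fin)
  have hS : ∀ x : {x | h x = 0}, Nonempty (SliceChart E
      (ULift.{u} (EuclideanSpace ℝ (Fin (Module.finrank ℝ V)))) {x | h x = 0}
      (Module.finrank ℝ E - Module.finrank ℝ V) x) := fun x ↦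
    SliceChart.exists_of_regular hh (hs x x.2) L (Nat.sub_add_cancel
      (LinearMap.finrank_le_finrank_of_surjective (M := E) (M' := V)
        (f := (mfderiv 𝓘(ℝ, E) 𝓘(ℝ, V) h x : E →L[ℝ] V).toLinearMap) (hs x x.2)))
  let S := fun x ↦ (hS x).some
  exact ⟨_, SliceChart.chartedSpace S, SliceChart.isManifold S, SliceChart.isSmoothEmbedding S,
    fun f hf ↦ SliceChart.contMDiff_of_coe S hf⟩

end RegularLevelSet

/-! ### Differential 2-forms on vector spaces -/

section FlatForms

open Set Topology VectorField

variable {E W X : Type*} [NormedAddCommGroup E] [NormedSpace ℝ E] [NormedAddCommGroup W]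
  [NormedSpace ℝ W] [NormedAddCommGroup X] [NormedSpace ℝ X]

variable (E) in
/-- An alternating 2-form seen as a bilinear map, as a continuous linear operation. -/
noncomputable def ContinuousAlternatingMap.toBilin :
    (E [⋀^Fin 2]→L[ℝ] ℝ) →L[ℝ] E →L[ℝ] E →L[ℝ] ℝ :=
  (ContinuousLinearMap.compL ℝ E (E [⋀^Fin 1]→L[ℝ] ℝ) (E →L[ℝ] ℝ)
    ((ContinuousAlternatingMap.ofSubsingletonLIE (𝕜 := ℝ) (E := E) (F := ℝ) (0 : Fin 1)).symm :
      (E [⋀^Fin 1]→L[ℝ] ℝ) →L[ℝ] E →L[ℝ] ℝ)).comp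
    (ContinuousAlternatingMap.curryLeftLI (𝕜 := ℝ) (E := E) (F := ℝ) (n := 1)).toContinuousLinearMap

@[simp] lemma ContinuousAlternatingMap.toBilin_apply (σ : E [⋀^Fin 2]→L[ℝ] ℝ) (a b : E) :
    ContinuousAlternatingMap.toBilin E σ a b = σ ![a, b] := by
  change σ (Matrix.vecCons a fun _ ↦ b) = σ ![a, b]
  congr 1
  ext i
  fin_cases i <;> rfl

lemma ContinuousAlternatingMap.contDiff_toBilin {n : WithTop ℕ∞} :
    ContDiff ℝ n (fun σ ↦ ContinuousAlternatingMap.toBilin E σ) :=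
  ContinuousLinearMap.contDiff (E := E [⋀^Fin 2]→L[ℝ] ℝ) (F := E →L[ℝ] E →L[ℝ] ℝ) _

lemma ContinuousAlternatingMap.hasFDerivAt_toBilin {τ : X → E [⋀^Fin 2]→L[ℝ] ℝ}
    {τ' : X →L[ℝ] E [⋀^Fin 2]→L[ℝ] ℝ} {y : X} (hτ : HasFDerivAt τ τ' y) :
    HasFDerivAt (fun z ↦ ContinuousAlternatingMap.toBilin E (τ z))
      ((ContinuousAlternatingMap.toBilin E).comp τ') y := by
  have h : HasFDerivAt (fun σ ↦ ContinuousAlternatingMap.toBilin E σ)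
      (ContinuousAlternatingMap.toBilin E) (τ y) :=
    ContinuousLinearMap.hasFDerivAt (E := E [⋀^Fin 2]→L[ℝ] ℝ) (F := E →L[ℝ] E →L[ℝ] ℝ) _
  exact HasFDerivAt.comp (g := fun σ ↦ ContinuousAlternatingMap.toBilin E σ) y h hτ

lemma ContinuousAlternatingMap.toBilin_swap (σ : E [⋀^Fin 2]→L[ℝ] ℝ) (a b : E) :
    ContinuousAlternatingMap.toBilin E σ a b = -ContinuousAlternatingMap.toBilin E σ b a := by
  rw [ContinuousAlternatingMap.toBilin_apply, ContinuousAlternatingMap.toBilin_apply]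
  have h := σ.toAlternatingMap.map_swap ![b, a] (i := 0) (j := 1) (by simp)
  have h2 : (![b, a] ∘ Equiv.swap (0 : Fin 2) 1) = ![a, b] := by
    ext i
    fin_cases i <;> simp
  rw [h2] at h
  exact h

/-- A 2-form on a finite-dimensional space which depends on a parameter is smooth in the parameter
if its values on all pairs of vectors are. -/
lemma contDiffOn_twoForm [FiniteDimensional ℝ W] {f : X → W [⋀^Fin 2]→L[ℝ] ℝ} {s : Set X}
    {n : WithTop ℕ∞} (hf : ∀ a b, ContDiffOn ℝ n (fun x ↦ f x ![a, b]) s) :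
    ContDiffOn ℝ n f s := by
  let b := Module.finBasis ℝ W
  let T : (W [⋀^Fin 2]→L[ℝ] ℝ) →ₗ[ℝ]
      (Fin (Module.finrank ℝ W) × Fin (Module.finrank ℝ W) → ℝ) :=
    { toFun := fun σ p ↦ σ ![b p.1, b p.2]
      map_add' := fun _ _ ↦ rfl
      map_smul' := fun _ _ ↦ rfl }
  have hT : LinearMap.ker T = ⊥ := by
    refine LinearMap.ker_eq_bot.2 fun σ σ' h ↦ ?_
    refine ContinuousAlternatingMap.toAlternatingMap_injective
      (b.ext_alternating fun v _ ↦ ?_)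
    have h1 := congrFun h (v 0, v 1)
    have h2 : (fun i ↦ b (v i)) = ![b (v 0), b (v 1)] := by
      ext i
      fin_cases i <;> rfl
    rw [h2]
    exact h1
  obtain ⟨S, hS⟩ := T.exists_leftInverse_of_injective hT
  have hfS : f = fun x ↦ LinearMap.toContinuousLinearMap S (T (f x)) := by
    ext1 x
    exact (LinearMap.congr_fun hS (f x)).symm
  rw [hfS]
  exact (LinearMap.toContinuousLinearMap S).contDiff.comp_contDiffOn
    (contDiffOn_pi.2 fun p ↦ hf _ _)

/-- The exterior derivative of a 2-form, written out. -/
lemma extDeriv_twoForm_apply {τ : E → E [⋀^Fin 2]→L[ℝ] ℝ} {y : E} (u v w : E) :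
    extDeriv τ y ![u, v, w] = ContinuousAlternatingMap.toBilin E (fderiv ℝ τ y u) v w -
      ContinuousAlternatingMap.toBilin E (fderiv ℝ τ y v) u w +
      ContinuousAlternatingMap.toBilin E (fderiv ℝ τ y w) u v := by
  have h0 : (0 : Fin 3).removeNth ![u, v, w] = ![v, w] := by
    ext i
    fin_cases i <;> rfl
  have h1 : (1 : Fin 3).removeNth ![u, v, w] = ![u, w] := by
    ext i
    fin_cases i <;> rfl
  have h2 : (2 : Fin 3).removeNth ![u, v, w] = ![u, v] := by
    ext i
    fin_cases i <;> rfl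
  rw [extDeriv, ContinuousAlternatingMap.alternatizeUncurryFin_apply, Fin.sum_univ_three, h0, h1,
    h2]
  simp [sub_eq_add_neg]

/-- The second derivative of a Hamiltonian function, in terms of the form and the field. -/
lemma hasFDerivAt_fderiv_of_hamiltonian {τ : E → E [⋀^Fin 2]→L[ℝ] ℝ} {Y : E → E} {K : E → ℝ}
    {y : E} (hτ : DifferentiableAt ℝ τ y) (hY : DifferentiableAt ℝ Y y)
    (hK : ∀ᶠ z in 𝓝 y, ∀ w, fderiv ℝ K z w = τ z ![Y z, w]) (u w : E) :
    fderiv ℝ (fderiv ℝ K) y u w =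
      ContinuousAlternatingMap.toBilin E (fderiv ℝ τ y u) (Y y) w +
        ContinuousAlternatingMap.toBilin E (τ y) (fderiv ℝ Y y u) w := by
  have h1 : fderiv ℝ K =ᶠ[𝓝 y] fun z ↦ ContinuousAlternatingMap.toBilin E (τ z) (Y z) := by
    filter_upwards [hK] with z hz
    ext w
    rw [hz w, ContinuousAlternatingMap.toBilin_apply]
  have h0 := ContinuousAlternatingMap.hasFDerivAt_toBilin hτ.hasFDerivAt
  have h2 := h0.clm_apply hY.hasFDerivAt
  rw [h1.fderiv_eq]
  rw [h2.fderiv]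
  simp [add_comm]

/-- The Poisson bracket of two Hamiltonian functions is a Hamiltonian function of minus the Lie
bracket of their vector fields; version on a vector space. -/
lemma fderiv_poisson {τ : E → E [⋀^Fin 2]→L[ℝ] ℝ} {Y Z : E → E} {H K : E → ℝ}
    {y : E} (hτ : DifferentiableAt ℝ τ y) (hdτ : extDeriv τ y = 0)
    (hY : DifferentiableAt ℝ Y y) (hZ : DifferentiableAt ℝ Z y)
    (hH : ContDiffAt ℝ 2 H y) (hK : ContDiffAt ℝ 2 K y)
    (hYH : ∀ᶠ z in 𝓝 y, ∀ w, fderiv ℝ H z w = τ z ![Y z, w])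
    (hZK : ∀ᶠ z in 𝓝 y, ∀ w, fderiv ℝ K z w = τ z ![Z z, w]) :
    HasFDerivAt (fun z ↦ τ z ![Y z, Z z])
      (-ContinuousAlternatingMap.toBilin E (τ y) (lieBracket ℝ Y Z y)) y := by
  have hsH := hH.isSymmSndFDerivAt (by simp)
  have hsK := hK.isSymmSndFDerivAt (by simp)
  have h0 := ContinuousAlternatingMap.hasFDerivAt_toBilin hτ.hasFDerivAt
  have h2 := (h0.clm_apply hY.hasFDerivAt).clm_apply hZ.hasFDerivAt
  simp only [ContinuousAlternatingMap.toBilin_apply] at h2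
  refine h2.congr_fderiv ?_
  ext w
  have e1 := hsH.eq (Z y) w
  have e2 := hsK.eq (Y y) w
  rw [hasFDerivAt_fderiv_of_hamiltonian hτ hY hYH, hasFDerivAt_fderiv_of_hamiltonian hτ hY hYH]
    at e1
  rw [hasFDerivAt_fderiv_of_hamiltonian hτ hZ hZK, hasFDerivAt_fderiv_of_hamiltonian hτ hZ hZK]
    at e2
  have e3 : extDeriv τ y ![w, Y y, Z y] = 0 := by rw [hdτ]; rfl
  rw [extDeriv_twoForm_apply] at e3
  have s1 := ContinuousAlternatingMap.toBilin_swap (fderiv ℝ τ y (Y y)) w (Z y)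
  have s2 := ContinuousAlternatingMap.toBilin_swap (fderiv ℝ τ y (Z y)) w (Y y)
  have s3 := ContinuousAlternatingMap.toBilin_swap (fderiv ℝ τ y w) (Z y) (Y y)
  have s4 := ContinuousAlternatingMap.toBilin_swap (τ y) (fderiv ℝ Z y w) (Y y)
  simp only [lieBracket_eq, map_sub, sub_apply, neg_apply, add_apply,
    ContinuousLinearMap.comp_apply, ContinuousLinearMap.flip_apply,
    ContinuousAlternatingMap.toBilin_apply] at *
  linarith

/-- A closed form is constant in the direction of a constant vector field which is Hamiltonian. -/
lemma fderiv_eq_zero_of_hamiltonian_const {τ : E → E [⋀^Fin 2]→L[ℝ] ℝ} {u : E} {η : E → ℝ} {y : E}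
    (hτ : DifferentiableAt ℝ τ y) (hdτ : extDeriv τ y = 0) (hη : ContDiffAt ℝ 2 η y)
    (huη : ∀ᶠ z in 𝓝 y, ∀ w, fderiv ℝ η z w = τ z ![u, w]) (a b : E) :
    fderiv ℝ τ y u ![a, b] = 0 := by
  have hs := hη.isSymmSndFDerivAt (by simp)
  have e1 := hs.eq a b
  rw [hasFDerivAt_fderiv_of_hamiltonian hτ (differentiableAt_const u) huη,
    hasFDerivAt_fderiv_of_hamiltonian hτ (differentiableAt_const u) huη] at e1
  have e2 : extDeriv τ y ![u, a, b] = 0 := by rw [hdτ]; rfl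
  rw [extDeriv_twoForm_apply] at e2
  simp at e1 e2
  linarith

end FlatForms

/-! ### Symplectic forms and Hamiltonian vector fields on manifolds -/

section ManifoldForms

open Set Topology VectorField

variable {E M W : Type*} [NormedAddCommGroup E] [NormedSpace ℝ E] [TopologicalSpace M]
  [ChartedSpace E M] [NormedAddCommGroup W] [NormedSpace ℝ W]

lemma two_le_infty : (2 : WithTop ℕ∞) ≤ ∞ := WithTop.coe_le_coe.2 (le_top : (2 : ℕ∞) ≤ ⊤)

/-- The values of a 2-form at two equal points agree, all tangent spaces being identified with the
model space. -/
lemma TwoForm.apply_congr (σ : TwoForm E M) {x x' : M} (h : x = x') (a b : E) :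
    (σ x : E [⋀^Fin 2]→L[ℝ] ℝ) ![a, b] = (σ x' : E [⋀^Fin 2]→L[ℝ] ℝ) ![a, b] := by
  subst h
  rfl

lemma TwoForm.pullback_apply {E' N : Type*} [NormedAddCommGroup E'] [NormedSpace ℝ E']
    [TopologicalSpace N] [ChartedSpace E' N] (σ : TwoForm E M) (g : N → M) (x : N)
    (a b : TangentSpace 𝓘(ℝ, E') x) :
    σ.pullback (F := E') g x ![a, b] =
      σ (g x) ![mfderiv 𝓘(ℝ, E') 𝓘(ℝ, E) g x a, mfderiv 𝓘(ℝ, E') 𝓘(ℝ, E) g x b] := by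
  change σ (g x) (mfderiv 𝓘(ℝ, E') 𝓘(ℝ, E) g x ∘ ![a, b]) = _
  congr 1
  ext i
  fin_cases i <;> rfl

/-- The pullback of a smooth closed form under a smooth map from an open subset of a vector space
is smooth and closed. -/
theorem TwoForm.IsSymplectic.pullback_flat [IsManifold 𝓘(ℝ, E) ∞ M] [FiniteDimensional ℝ W]
    {σ : TwoForm E M} (hσ : σ.IsSymplectic) {g : W → M} {U : Set W} (hU : IsOpen U)
    (hg : ContMDiffOn 𝓘(ℝ, W) 𝓘(ℝ, E) ∞ g U) {τ : W → W [⋀^Fin 2]→L[ℝ] ℝ}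
    (hτ : τ = σ.pullback (F := W) g) :
    ContDiffOn ℝ ∞ τ U ∧ ∀ w ∈ U, extDeriv τ w = 0 := by
  have key : ∀ w₀ ∈ U, ContDiffAt ℝ ∞ τ w₀ ∧ extDeriv τ w₀ = 0 := by
    intro w₀ hw₀
    set x₀ := g w₀ with hx₀
    set e := extChartAt 𝓘(ℝ, E) x₀ with he
    set f : W → E := fun w ↦ e (g w) with hf_def
    set U' : Set W := U ∩ g ⁻¹' e.source with hU'
    have hU'o : IsOpen U' := hg.continuousOn.isOpen_inter_preimage hU (isOpen_extChartAt_source x₀)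
    have hw₀' : w₀ ∈ U' := ⟨hw₀, mem_extChartAt_source x₀⟩
    have hf : ContDiffOn ℝ ∞ f U' := by
      rw [← contMDiffOn_iff_contDiffOn]
      exact contMDiffOn_extChartAt.comp (hg.mono inter_subset_left) fun w hw ↦
        extChartAt_source 𝓘(ℝ, E) x₀ ▸ hw.2
    have hft : MapsTo f U' e.target := fun w hw ↦ e.map_source hw.2
    have hf' : ContDiffOn ℝ ∞ (fderiv ℝ f) U' := hf.fderiv_of_isOpen hU'o (by simp)
    have hσf : ContDiffOn ℝ ∞ (fun w ↦ σ.inChart x₀ (f w)) U' := (hσ.smooth x₀).comp hf hft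
    have hdg : ∀ w ∈ U', ∀ a : W, (mfderiv 𝓘(ℝ, W) 𝓘(ℝ, E) g w a : E) =
        mfderiv 𝓘(ℝ, E) 𝓘(ℝ, E) e.symm (f w) (fderiv ℝ f w a) := by
      intro w hw a
      have h1 := ((contMDiffAt_extChartAt_symm (hft hw)).mdifferentiableAt (by simp)).hasMFDerivAt
      have h2 := ((hf.contDiffAt (hU'o.mem_nhds hw)).differentiableAt (by simp)).hasFDerivAt
      have h3 := h1.comp w h2.hasMFDerivAt
      have h4 : g =ᶠ[𝓝 w] e.symm ∘ f := by
        filter_upwards [hU'o.mem_nhds hw] with z hz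
        exact (e.left_inv hz.2).symm
      rw [(h3.congr_of_eventuallyEq h4).mfderiv]
      rfl
    have hτf : ∀ w ∈ U', τ w =
        (σ.inChart x₀ (f w)).compContinuousLinearMap (fderiv ℝ f w) := by
      intro w hw
      ext v
      have hv : v = ![v 0, v 1] := by
        ext i
        fin_cases i <;> rfl
      have hv' : (fderiv ℝ f w ∘ v) = ![fderiv ℝ f w (v 0), fderiv ℝ f w (v 1)] := by
        ext i
        fin_cases i <;> rfl
      rw [ContinuousAlternatingMap.compContinuousLinearMap_apply, hv', hv, hτ]
      refine (TwoForm.pullback_apply σ g w (v 0) (v 1)).trans ?_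
      refine Eq.trans ?_ (TwoForm.pullback_apply σ e.symm (f w) (fderiv ℝ f w (v 0))
        (fderiv ℝ f w (v 1))).symm
      refine Eq.trans ?_ (TwoForm.apply_congr σ (e.left_inv hw.2).symm _ _)
      rw [hdg w hw (v 0), hdg w hw (v 1)]
    constructor
    · have h : ContDiffOn ℝ ∞ τ U' := by
        refine contDiffOn_twoForm fun a b ↦ ?_
        have h1 : ContDiffOn ℝ ∞
            (fun w ↦ ContinuousAlternatingMap.toBilin E (σ.inChart x₀ (f w))) U' :=
          ContinuousAlternatingMap.contDiff_toBilin.comp_contDiffOn hσf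
        have h2 := (h1.clm_apply (hf'.clm_apply (contDiffOn_const (c := a)))).clm_apply
          (hf'.clm_apply (contDiffOn_const (c := b)))
        refine h2.congr fun w hw ↦ ?_
        rw [hτf w hw, ContinuousAlternatingMap.toBilin_apply,
          ContinuousAlternatingMap.compContinuousLinearMap_apply]
        congr 1
        ext i
        fin_cases i <;> rfl
      exact h.contDiffAt (hU'o.mem_nhds hw₀')
    · have h1 : τ =ᶠ[𝓝 w₀]
          fun w ↦ (σ.inChart x₀ (f w)).compContinuousLinearMap (fderiv ℝ f w) := by
        filter_upwards [hU'o.mem_nhds hw₀'] with w hw using hτf w hw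
      have h2 : DifferentiableAt ℝ (σ.inChart x₀) (f w₀) :=
        ((hσ.smooth x₀).contDiffAt ((isOpen_extChartAt_target x₀).mem_nhds
          (hft hw₀'))).differentiableAt (by simp)
      rw [h1.extDeriv_eq, extDeriv_pullback h2 (hf.contDiffAt (hU'o.mem_nhds hw₀'))
        (by rw [minSmoothness_of_isRCLikeNormedField]; exact two_le_infty),
        hσ.closed x₀ _ (hft hw₀')]
      ext v
      rfl
  exact ⟨fun w hw ↦ (key w hw).1.contDiffWithinAt, fun w hw ↦ (key w hw).2⟩

/-- The differential of a Hamiltonian function, pulled back to a vector space. -/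
lemma TwoForm.IsHamiltonianVectorField.fderiv_comp {σ : TwoForm E M} {H : M → ℝ}
    {X : ∀ x : M, TangentSpace 𝓘(ℝ, E) x} (h : σ.IsHamiltonianVectorField H X) {g : W → M} {w : W}
    (hH : MDifferentiableAt 𝓘(ℝ, E) 𝓘(ℝ, ℝ) H (g w))
    (hg : MDifferentiableAt 𝓘(ℝ, W) 𝓘(ℝ, E) g w) (a : W) :
    fderiv ℝ (fun w ↦ H (g w)) w a =
      σ (g w) ![X (g w), mfderiv 𝓘(ℝ, W) 𝓘(ℝ, E) g w a] := by
  have h1 := mfderiv_comp_apply w hH hg a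
  rw [mfderiv_eq_fderiv] at h1
  exact h1.trans (h (g w) _)

/-- Pairing two vector fields with a form, computed in a chart. -/
lemma TwoForm.inChart_apply_inChart [IsManifold 𝓘(ℝ, E) ∞ M] (σ : TwoForm E M)
    (X Y : ∀ x : M, TangentSpace 𝓘(ℝ, E) x) {x₀ : M} {y : E}
    (hy : y ∈ (extChartAt 𝓘(ℝ, E) x₀).target) :
    σ.inChart x₀ y ![VectorField.inChart (E := E) X x₀ y, VectorField.inChart (E := E) Y x₀ y] =
      σ ((extChartAt 𝓘(ℝ, E) x₀).symm y) ![X _, Y _] := by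
  refine (TwoForm.pullback_apply σ _ y _ _).trans ?_
  rw [mfderiv_symm_inChart X hy, mfderiv_symm_inChart Y hy]

lemma mfderiv_extChartAt_symm_mfderiv_extChartAt [IsManifold 𝓘(ℝ, E) ∞ M] {x₀ x : M}
    (hx : x ∈ (extChartAt 𝓘(ℝ, E) x₀).source) (a : TangentSpace 𝓘(ℝ, E) x) :
    (mfderiv 𝓘(ℝ, E) 𝓘(ℝ, E) (extChartAt 𝓘(ℝ, E) x₀).symm (extChartAt 𝓘(ℝ, E) x₀ x)
      (mfderiv 𝓘(ℝ, E) 𝓘(ℝ, E) (extChartAt 𝓘(ℝ, E) x₀) x a) : E) = a := by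
  have : IsManifold 𝓘(ℝ, E) 1 M := .of_le (n := ∞) (by simp)
  have h1 := mfderivWithin_extChartAt_symm_comp_mfderiv_extChartAt' (I := 𝓘(ℝ, E)) hx
  rw [ModelWithCorners.range_eq_univ, mfderivWithin_univ] at h1
  exact DFunLike.congr_fun h1 a

lemma mfderiv_extChartAt_mfderiv_extChartAt_symm [IsManifold 𝓘(ℝ, E) ∞ M] {x₀ x : M}
    (hx : x ∈ (extChartAt 𝓘(ℝ, E) x₀).source) (a : E) :
    (mfderiv 𝓘(ℝ, E) 𝓘(ℝ, E) (extChartAt 𝓘(ℝ, E) x₀) x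
      (mfderiv 𝓘(ℝ, E) 𝓘(ℝ, E) (extChartAt 𝓘(ℝ, E) x₀).symm (extChartAt 𝓘(ℝ, E) x₀ x) a) : E) =
        a := by
  have : IsManifold 𝓘(ℝ, E) 1 M := .of_le (n := ∞) (by simp)
  have h1 := mfderiv_extChartAt_comp_mfderivWithin_extChartAt_symm' (I := 𝓘(ℝ, E)) hx
  rw [ModelWithCorners.range_eq_univ, mfderivWithin_univ] at h1
  exact DFunLike.congr_fun h1 a

lemma VectorField.mlieBracket_eq_mfderiv_symm [IsManifold 𝓘(ℝ, E) ∞ M]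
    (X Y : ∀ x : M, TangentSpace 𝓘(ℝ, E) x) (x : M) :
    (mlieBracket 𝓘(ℝ, E) X Y x : E) =
      mfderiv 𝓘(ℝ, E) 𝓘(ℝ, E) (extChartAt 𝓘(ℝ, E) x).symm (extChartAt 𝓘(ℝ, E) x x)
        (lieBracket (E := E) ℝ (VectorField.inChart (E := E) X x) (VectorField.inChart (E := E) Y x)
          (extChartAt 𝓘(ℝ, E) x x : E)) := by
  have : IsManifold 𝓘(ℝ, E) 1 M := .of_le (n := ∞) (by simp)
  have h : mlieBracket 𝓘(ℝ, E) X Y x =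
      (mfderiv 𝓘(ℝ, E) 𝓘(ℝ, E) (extChartAt 𝓘(ℝ, E) x) x).inverse
        (lieBracket (E := E) ℝ (VectorField.inChart (E := E) X x) (VectorField.inChart (E := E) Y x)
          (extChartAt 𝓘(ℝ, E) x x : E)) := by
    rw [← mlieBracketWithin_univ, mlieBracketWithin_apply, ModelWithCorners.range_eq_univ,
      preimage_univ, univ_inter]
    refine congrArg _ ((congrFun (lieBracketWithin_univ (𝕜 := ℝ) (E := E)) _).trans ?_)
    exact congrArg₂ (fun a b ↦ lieBracket (E := E) ℝ a b (extChartAt 𝓘(ℝ, E) x x))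
      mpullbackWithin_univ mpullbackWithin_univ
  rw [h]
  refine ((isInvertible_mfderiv_extChartAt (I := 𝓘(ℝ, E))
    (mem_extChartAt_source x)).inverse_apply_eq).2 ?_
  exact (mfderiv_extChartAt_mfderiv_extChartAt_symm (mem_extChartAt_source x) _).symm

/-- The Poisson bracket `σ(X, Y)` of two Hamiltonian functions is a Hamiltonian function of minus
the Lie bracket of their vector fields. -/
theorem TwoForm.IsSymplectic.hasMFDerivAt_poisson [FiniteDimensional ℝ E] [IsManifold 𝓘(ℝ, E) ∞ M]
    {σ : TwoForm E M} (hσ : σ.IsSymplectic) {H K : M → ℝ} {X Y : ∀ x : M, TangentSpace 𝓘(ℝ, E) x}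
    (hX : ContMDiff 𝓘(ℝ, E) 𝓘(ℝ, E).tangent ∞
      (fun x ↦ (⟨x, X x⟩ : TangentBundle 𝓘(ℝ, E) M)))
    (hY : ContMDiff 𝓘(ℝ, E) 𝓘(ℝ, E).tangent ∞
      (fun x ↦ (⟨x, Y x⟩ : TangentBundle 𝓘(ℝ, E) M)))
    (hH : ContMDiff 𝓘(ℝ, E) 𝓘(ℝ, ℝ) ∞ H) (hK : ContMDiff 𝓘(ℝ, E) 𝓘(ℝ, ℝ) ∞ K)
    (hXH : σ.IsHamiltonianVectorField H X) (hYK : σ.IsHamiltonianVectorField K Y) (x : M) :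
    ∃ L : TangentSpace 𝓘(ℝ, E) x →L[ℝ] ℝ,
      HasMFDerivAt 𝓘(ℝ, E) 𝓘(ℝ, ℝ) (fun x ↦ σ x ![X x, Y x]) x L ∧
      ∀ w, L w = -σ x ![mlieBracket 𝓘(ℝ, E) X Y x, w] := by
  have : IsManifold 𝓘(ℝ, E) 1 M := .of_le (n := ∞) (by simp)
  have : CompleteSpace E := FiniteDimensional.complete ℝ E
  set e := extChartAt 𝓘(ℝ, E) x with he
  have hy : e x ∈ e.target := mem_extChartAt_target x
  have ht : e.target ∈ 𝓝 (e x) := (isOpen_extChartAt_target x).mem_nhds hy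
  have hsymm : ∀ z ∈ e.target, MDifferentiableAt 𝓘(ℝ, E) 𝓘(ℝ, E) e.symm z := fun z hz ↦
    (contMDiffAt_extChartAt_symm hz).mdifferentiableAt (by simp)
  have hfun : ∀ {H : M → ℝ}, ContMDiff 𝓘(ℝ, E) 𝓘(ℝ, ℝ) ∞ H →
      ContDiffAt ℝ 2 (fun z ↦ H (e.symm z)) (e x) := fun hH ↦ by
    have h : ContMDiffAt 𝓘(ℝ, E) 𝓘(ℝ, ℝ) ∞ (fun z ↦ _) (e x) :=
      ContMDiffAt.comp (e x) (hH _) (contMDiffAt_extChartAt_symm hy)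
    exact h.contDiffAt.of_le two_le_infty
  have hham : ∀ {H : M → ℝ} {X : ∀ x : M, TangentSpace 𝓘(ℝ, E) x},
      ContMDiff 𝓘(ℝ, E) 𝓘(ℝ, ℝ) ∞ H → σ.IsHamiltonianVectorField H X →
      ∀ᶠ z in 𝓝 (e x), ∀ w, fderiv ℝ (fun z ↦ H (e.symm z)) z w =
        σ.inChart x z ![VectorField.inChart (E := E) X x z, w] := fun {H X} hH hXH ↦ by
    filter_upwards [ht] with z hz w
    rw [hXH.fderiv_comp (hH.mdifferentiableAt (by simp)) (hsymm z hz)]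
    refine Eq.trans ?_ (TwoForm.pullback_apply σ _ z _ _).symm
    rw [mfderiv_symm_inChart X hz]
  have hd := fderiv_poisson (((hσ.smooth x).contDiffAt ht).differentiableAt (by simp))
    (hσ.closed x _ hy) (((contDiffOn_inChart hX x).contDiffAt ht).differentiableAt (by simp))
    (((contDiffOn_inChart hY x).contDiffAt ht).differentiableAt (by simp))
    (hfun hH) (hfun hK) (hham hH hXH) (hham hK hYK)
  have he' : MDifferentiableAt 𝓘(ℝ, E) 𝓘(ℝ, E) e x :=
    mdifferentiableAt_extChartAt (mem_chart_source E x)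
  have h1 := hd.hasMFDerivAt.comp x he'.hasMFDerivAt
  refine ⟨_, h1.congr_of_eventuallyEq ?_, fun w ↦ ?_⟩
  · filter_upwards [extChartAt_source_mem_nhds (I := 𝓘(ℝ, E)) x] with z hz
    rw [Function.comp_apply, TwoForm.inChart_apply_inChart σ X Y (e.map_source hz)]
    rw [e.left_inv hz]
  · change -ContinuousAlternatingMap.toBilin E (σ.inChart x (e x))
      (lieBracket (E := E) ℝ (VectorField.inChart (E := E) X x)
        (VectorField.inChart (E := E) Y x) (e x))
      (mfderiv 𝓘(ℝ, E) 𝓘(ℝ, E) e x w) = _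
    refine (congrArg Neg.neg (ContinuousAlternatingMap.toBilin_apply _ _ _)).trans
      (congrArg Neg.neg ?_)
    refine (TwoForm.pullback_apply σ _ (e x) _ _).trans ?_
    refine (TwoForm.apply_congr σ (extChartAt_to_inv x) _ _).trans ?_
    have h2 := mfderiv_extChartAt_symm_mfderiv_extChartAt (mem_extChartAt_source x) w
    have h3 := mlieBracket_eq_mfderiv_symm X Y x
    exact congrArg₂ (fun a b : E ↦ (σ x : E [⋀^Fin 2]→L[ℝ] ℝ) ![a, b]) h3.symm h2

end ManifoldForms

/-! ### Flows of Hamiltonian vector fields -/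

section HamiltonianFlow

open Set Topology VectorField

variable {E M : Type*} [NormedAddCommGroup E] [NormedSpace ℝ E] [TopologicalSpace M]
  [ChartedSpace E M]

lemma eq_of_hasMFDerivAt_zero [IsManifold 𝓘(ℝ, E) ∞ M] [PreconnectedSpace M] {f : M → ℝ}
    (hf : ∀ x, HasMFDerivAt 𝓘(ℝ, E) 𝓘(ℝ, ℝ) f x (0 : E →L[ℝ] ℝ)) (x y : M) : f x = f y := by
  refine ((IsLocallyConstant.iff_eventually_eq f).2 fun x₀ ↦ ?_).apply_eq_of_preconnectedSpace x y
  set e := extChartAt 𝓘(ℝ, E) x₀ with he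
  obtain ⟨r, hr, hball⟩ := Metric.isOpen_iff.1 (isOpen_extChartAt_target (I := 𝓘(ℝ, E)) x₀) (e x₀)
    (mem_extChartAt_target x₀)
  have hd : ∀ z ∈ Metric.ball (e x₀) r,
      HasFDerivAt (fun z ↦ f (e.symm z)) (0 : E →L[ℝ] ℝ) z := by
    intro z hz
    have h1 := ((contMDiffAt_extChartAt_symm (hball hz)).mdifferentiableAt (by simp)).hasMFDerivAt
    have h2 := ((hf (e.symm z)).comp z h1).hasFDerivAt
    exact h2
  have hc : ContinuousAt e x₀ := continuousAt_extChartAt x₀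
  filter_upwards [hc (Metric.ball_mem_nhds _ hr),
    extChartAt_source_mem_nhds (I := 𝓘(ℝ, E)) x₀] with x hx hxs
  have := Metric.isOpen_ball.is_const_of_fderiv_eq_zero (convex_ball _ _).isPreconnected
    (fun z hz ↦ (hd z hz).differentiableAt.differentiableWithinAt)
    (fun z hz ↦ (hd z hz).fderiv) hx (Metric.mem_ball_self hr)
  change f (e.symm (e x)) = f (e.symm (e x₀)) at this
  rwa [e.left_inv hxs, e.left_inv (mem_extChartAt_source x₀)] at this

/-- `X` is a smooth vector field with smooth Hamiltonian function `H`. -/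
structure TwoForm.IsHamiltonianPair [IsManifold 𝓘(ℝ, E) ∞ M] (σ : TwoForm E M) (H : M → ℝ)
    (X : ∀ x : M, TangentSpace 𝓘(ℝ, E) x) : Prop where
  contMDiff_field : ContMDiff 𝓘(ℝ, E) 𝓘(ℝ, E).tangent ∞
    (fun x ↦ (⟨x, X x⟩ : TangentBundle 𝓘(ℝ, E) M))
  contMDiff_function : ContMDiff 𝓘(ℝ, E) 𝓘(ℝ, ℝ) ∞ H
  isHamiltonianVectorField : σ.IsHamiltonianVectorField H X

namespace ContinuousAlternatingMap

variable (τ : E [⋀^Fin 2]→L[ℝ] ℝ) (r : ℝ) (a b c : E)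

lemma apply_add_left : τ ![a + b, c] = τ ![a, c] + τ ![b, c] := by
  simp only [← toBilin_apply, map_add, _root_.add_apply]

lemma apply_smul_left : τ ![r • a, c] = r * τ ![a, c] := by
  simp only [← toBilin_apply, map_smul, _root_.smul_apply, smul_eq_mul]

lemma apply_smul_right : τ ![c, r • a] = r * τ ![c, a] := by
  simp only [← toBilin_apply, map_smul, smul_eq_mul]

lemma apply_swap : τ ![a, b] = -τ ![b, a] := by
  simpa only [toBilin_apply] using toBilin_swap τ a b

lemma apply_add_right : τ ![c, a + b] = τ ![c, a] + τ ![c, b] := by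
  simp only [← toBilin_apply, map_add]

end ContinuousAlternatingMap

namespace TwoForm

variable {σ : TwoForm E M} {H K : M → ℝ} {X Y : ∀ x : M, TangentSpace 𝓘(ℝ, E) x}

lemma apply_self (σ : TwoForm E M) (x : M) (a : TangentSpace 𝓘(ℝ, E) x) : σ x ![a, a] = 0 :=
  (σ x).map_eq_zero_of_eq (i := 0) (j := 1) _ rfl (by decide)

/-- Two vectors with the same pairings with all vectors of a symplectic tangent space agree. -/
lemma IsSymplectic.eq_of_forall_apply_eq (hσ : σ.IsSymplectic) {x : M}
    {a b : E} (h : ∀ w : E, (σ x : E [⋀^Fin 2]→L[ℝ] ℝ) ![a, w] =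
      (σ x : E [⋀^Fin 2]→L[ℝ] ℝ) ![b, w]) : a = b := by
  have h0 : a + (-1 : ℝ) • b = 0 := hσ.nondegenerate x (a + (-1 : ℝ) • b : E) fun w ↦ by
    refine (ContinuousAlternatingMap.apply_add_left (E := E) (σ x) a _ w).trans ?_
    have h1 := ContinuousAlternatingMap.apply_smul_left (E := E) (σ x) (-1) b w
    exact (congrArg₂ (· + ·) (h w) (h1.trans (neg_one_mul _))).trans (add_neg_cancel _)
  rwa [neg_one_smul, ← sub_eq_add_neg, sub_eq_zero] at h0

/-- Commuting Hamiltonian vector fields on a connected manifold have constant pairing. -/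
theorem IsSymplectic.apply_eq_of_mlieBracket_eq_zero [FiniteDimensional ℝ E]
    [IsManifold 𝓘(ℝ, E) ∞ M] [PreconnectedSpace M] (hσ : σ.IsSymplectic)
    (hX : σ.IsHamiltonianPair H X) (hY : σ.IsHamiltonianPair K Y)
    (h : mlieBracket 𝓘(ℝ, E) X Y = 0) (x y : M) :
    σ x ![X x, Y x] = σ y ![X y, Y y] := by
  refine eq_of_hasMFDerivAt_zero (E := E) (f := fun x ↦ σ x ![X x, Y x]) (fun z ↦ ?_) x y
  obtain ⟨L, hL, hL'⟩ := hσ.hasMFDerivAt_poisson hX.contMDiff_field hY.contMDiff_field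
    hX.contMDiff_function hY.contMDiff_function hX.isHamiltonianVectorField
    hY.isHamiltonianVectorField z
  have : L = (0 : E →L[ℝ] ℝ) := by
    ext w
    refine (hL' w).trans ?_
    rw [h]
    exact neg_eq_zero.2 ((σ z).map_coord_zero (m := ![0, w]) 0 rfl)
  exact this ▸ hL

/-- Hamiltonian vector fields with constant pairing commute. -/
theorem IsSymplectic.mlieBracket_eq_zero_of_apply_eq [FiniteDimensional ℝ E]
    [IsManifold 𝓘(ℝ, E) ∞ M] (hσ : σ.IsSymplectic)
    (hX : σ.IsHamiltonianPair H X) (hY : σ.IsHamiltonianPair K Y) {c : ℝ}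
    (h : ∀ x, σ x ![X x, Y x] = c) : mlieBracket 𝓘(ℝ, E) X Y = 0 := by
  ext1 z
  obtain ⟨L, hL, hL'⟩ := hσ.hasMFDerivAt_poisson hX.contMDiff_field hY.contMDiff_field
    hX.contMDiff_function hY.contMDiff_function hX.isHamiltonianVectorField
    hY.isHamiltonianVectorField z
  rw [show (fun x ↦ σ x ![X x, Y x]) = fun _ ↦ c from funext h] at hL
  have : L = (0 : E →L[ℝ] ℝ) := hasMFDerivAt_unique hL (hasMFDerivAt_const c z)
  refine hσ.nondegenerate z _ fun w ↦ neg_eq_zero.1 ((hL' w).symm.trans ?_)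
  rw [this]
  rfl

end TwoForm

namespace IsFlow

variable {σ : TwoForm E M} {H K : M → ℝ} {X Y : ∀ x : M, TangentSpace 𝓘(ℝ, E) x} {φ ψ : ℝ → M → M}
  {c : ℝ}

/-- A function whose derivative along the vector field is constant is affine along the flow. -/
lemma apply_eq_add_mul (hφ : IsFlow X φ) (hK : MDifferentiable 𝓘(ℝ, E) 𝓘(ℝ, ℝ) K)
    (h : ∀ x, (mfderiv 𝓘(ℝ, E) 𝓘(ℝ, ℝ) K x (X x) : ℝ) = c) (t : ℝ) (x : M) :
    K (φ t x) = K x + t * c := by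
  have hd : ∀ s, HasDerivAt (fun s ↦ K (φ s x) - s * c) 0 s := by
    intro s
    obtain ⟨L, hL, hLc⟩ : ∃ L : ℝ →L[ℝ] ℝ, HasFDerivAt (fun s ↦ K (φ s x)) L s ∧ L 1 = c := by
      refine ⟨_, ((hK (φ s x)).hasMFDerivAt.comp s (hφ.isMIntegralCurve x s)).hasFDerivAt, ?_⟩
      exact (congrArg (mfderiv 𝓘(ℝ, E) 𝓘(ℝ, ℝ) K (φ s x)) (one_smul ℝ (X (φ s x) : E))).trans
        (h (φ s x))
    have h2 : HasDerivAt (fun s ↦ K (φ s x)) c s := hLc ▸ hL.hasDerivAt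
    simpa using h2.fun_sub ((hasDerivAt_id s).mul_const c)
  have := is_const_of_deriv_eq_zero (fun s ↦ (hd s).differentiableAt) (fun s ↦ (hd s).deriv) t 0
  simp only [hφ.map_zero] at this
  linarith

variable [IsManifold 𝓘(ℝ, E) ∞ M] [T2Space M] [FiniteDimensional ℝ E]

lemma contMDiff_map (hφ : IsFlow X φ) (hX : ContMDiff 𝓘(ℝ, E) 𝓘(ℝ, E).tangent ∞
      (fun x ↦ (⟨x, X x⟩ : TangentBundle 𝓘(ℝ, E) M))) (t : ℝ) :
    ContMDiff 𝓘(ℝ, E) 𝓘(ℝ, E) ∞ (φ t) :=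
  (hφ.contMDiff hX).comp (contMDiff_const.prodMk contMDiff_id)

/-- The derivative of a flow in both the time and the space variable. -/
lemma mfderiv_uncurry_apply (hφ : IsFlow X φ) (hX : ContMDiff 𝓘(ℝ, E) 𝓘(ℝ, E).tangent ∞
      (fun x ↦ (⟨x, X x⟩ : TangentBundle 𝓘(ℝ, E) M))) (t : ℝ) (x : M) (s : ℝ) (a : E) :
    (mfderiv (𝓘(ℝ, ℝ).prod 𝓘(ℝ, E)) 𝓘(ℝ, E) (fun p : ℝ × M ↦ φ p.1 p.2) (t, x) (s, a) : E) =
      s • (X (φ t x) : E) + mfderiv 𝓘(ℝ, E) 𝓘(ℝ, E) (φ t) x a := by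
  refine (mfderiv_prod_eq_add_apply ((hφ.contMDiff hX).mdifferentiableAt (by simp))).trans ?_
  exact congrArg (· + (mfderiv 𝓘(ℝ, E) 𝓘(ℝ, E) (φ t) x a : E))
    (congrArg (fun L : ℝ →L[ℝ] E ↦ L s) (hφ.isMIntegralCurve x t).mfderiv)

/-- A symplectic form is preserved by the flow of a Hamiltonian vector field. -/
theorem apply_mfderiv_mfderiv (hφ : IsFlow X φ) (hσ : σ.IsSymplectic)
    (hX : σ.IsHamiltonianPair H X) (t : ℝ) (x : M) (a b : TangentSpace 𝓘(ℝ, E) x) :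
    σ (φ t x) ![mfderiv 𝓘(ℝ, E) 𝓘(ℝ, E) (φ t) x a, mfderiv 𝓘(ℝ, E) 𝓘(ℝ, E) (φ t) x b] =
      σ x ![a, b] := by
  set e := extChartAt 𝓘(ℝ, E) x with he
  set U : Set (ℝ × E) := univ ×ˢ e.target with hU
  have hUo : IsOpen U := isOpen_univ.prod (isOpen_extChartAt_target x)
  set g : ℝ × E → M := fun p ↦ φ p.1 (e.symm p.2) with hg_def
  have hg : ContMDiffOn 𝓘(ℝ, ℝ × E) 𝓘(ℝ, E) ∞ g U := by
    intro p hp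
    have h1 : ContMDiffAt 𝓘(ℝ, ℝ × E) 𝓘(ℝ, E) ∞ (fun p : ℝ × E ↦ e.symm p.2) p :=
      ContMDiffAt.comp (g := e.symm) (f := Prod.snd) p (contMDiffAt_extChartAt_symm hp.2)
        contDiff_snd.contMDiff.contMDiffAt
    exact (ContMDiffAt.comp (g := fun p : ℝ × M ↦ φ p.1 p.2) (f := fun p ↦ (p.1, e.symm p.2)) p
      (hφ.contMDiff hX.contMDiff_field).contMDiffAt
      (contDiff_fst.contMDiff.contMDiffAt.prodMk h1)).contMDiffWithinAt
  set τ : ℝ × E → (ℝ × E) [⋀^Fin 2]→L[ℝ] ℝ := σ.pullback (F := ℝ × E) g with hτ_def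
  obtain ⟨hτ, hdτ⟩ := hσ.pullback_flat hUo hg hτ_def
  have hgd : ∀ p ∈ U, MDifferentiableAt 𝓘(ℝ, ℝ × E) 𝓘(ℝ, E) g p := fun p hp ↦
    (hg.contMDiffAt (hUo.mem_nhds hp)).mdifferentiableAt (by simp)
  have hη : ∀ p ∈ U, ContDiffAt ℝ 2 (fun p ↦ H (g p)) p := fun p hp ↦
    ((hX.contMDiff_function.comp_contMDiffOn hg).contMDiffAt
      (hUo.mem_nhds hp)).contDiffAt.of_le two_le_infty
  have hg1 : ∀ p ∈ U, (mfderiv 𝓘(ℝ, ℝ × E) 𝓘(ℝ, E) g p ((1, 0) : ℝ × E) : E) = X (g p) := by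
    intro p hp
    have h1 : HasFDerivAt (fun s : ℝ ↦ (s, p.2)) (ContinuousLinearMap.inl ℝ ℝ E) p.1 :=
      hasFDerivAt_prodMk_left p.1 p.2
    have h2 := (hgd p hp).hasMFDerivAt.comp p.1 h1.hasMFDerivAt
    have h3 := hasMFDerivAt_unique h2 (hφ.isMIntegralCurve (e.symm p.2) p.1)
    refine (congrArg (fun L : ℝ →L[ℝ] E ↦ L 1) h3).trans ?_
    exact one_smul ℝ (X (g p) : E)
  have huη : ∀ p ∈ U, ∀ w : ℝ × E, fderiv ℝ (fun p ↦ H (g p)) p w = τ p ![(1, 0), w] := by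
    intro p hp w
    rw [hX.isHamiltonianVectorField.fderiv_comp
      (hX.contMDiff_function.mdifferentiableAt (by simp)) (hgd p hp)]
    refine Eq.trans ?_ (TwoForm.pullback_apply σ g p _ _).symm
    rw [hg1 p hp]
  set a' : ℝ × E := (0, mfderiv 𝓘(ℝ, E) 𝓘(ℝ, E) e x a) with ha'
  set b' : ℝ × E := (0, mfderiv 𝓘(ℝ, E) 𝓘(ℝ, E) e x b) with hb'
  have hmem : ∀ s : ℝ, (s, e x) ∈ U := fun s ↦ ⟨trivial, mem_extChartAt_target x⟩
  have hconst : ∀ s : ℝ, HasDerivAt (fun s : ℝ ↦ τ (s, e x) ![a', b']) 0 s := by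
    intro s
    have h0 := hUo.mem_nhds (hmem s)
    have hτd : DifferentiableAt ℝ τ (s, e x) := (hτ.contDiffAt h0).differentiableAt (by simp)
    have h1 := ContinuousAlternatingMap.hasFDerivAt_toBilin hτd.hasFDerivAt
    have h2 := (h1.clm_apply (hasFDerivAt_const a' _)).clm_apply (hasFDerivAt_const b' _)
    have h3 : HasDerivAt (fun s : ℝ ↦ (s, e x)) ((1, 0) : ℝ × E) s :=
      (hasDerivAt_id s).prodMk (hasDerivAt_const s _)
    have h4 := h2.comp_hasDerivAt s h3
    simp only [Function.comp_def, ContinuousAlternatingMap.toBilin_apply] at h4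
    refine h4.congr_deriv ?_
    have h5 := fderiv_eq_zero_of_hamiltonian_const hτd (hdτ _ (hmem s)) (hη _ (hmem s))
      (Filter.eventually_of_mem h0 huη) a' b'
    simpa using h5
  have key : ∀ s : ℝ, τ (s, e x) ![a', b'] =
      σ (φ s x) ![mfderiv 𝓘(ℝ, E) 𝓘(ℝ, E) (φ s) x a, mfderiv 𝓘(ℝ, E) 𝓘(ℝ, E) (φ s) x b] := by
    intro s
    have he' : HasMFDerivAt 𝓘(ℝ, E) 𝓘(ℝ, E) e x _ :=
      (mdifferentiableAt_extChartAt (mem_chart_source E x)).hasMFDerivAt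
    have h1 : HasFDerivAt (fun y : E ↦ (s, y)) (ContinuousLinearMap.inr ℝ ℝ E) (e x) :=
      hasFDerivAt_prodMk_right s (e x)
    have h2 := ((hgd _ (hmem s)).hasMFDerivAt.comp (e x) h1.hasMFDerivAt).comp x he'
    have h3 : φ s =ᶠ[𝓝 x] (g ∘ fun y : E ↦ (s, y)) ∘ e := by
      filter_upwards [extChartAt_source_mem_nhds (I := 𝓘(ℝ, E)) x] with z hz
      exact congrArg (φ s) (e.left_inv hz).symm
    have h4 := (h2.congr_of_eventuallyEq h3).mfderiv
    refine (TwoForm.pullback_apply σ g _ _ _).trans ?_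
    refine (TwoForm.apply_congr σ (x' := φ s x) (congrArg (φ s) (extChartAt_to_inv x)) _ _).trans ?_
    exact (congrArg (fun L : E →L[ℝ] E ↦ (σ (φ s x) : E [⋀^Fin 2]→L[ℝ] ℝ) ![L a, L b]) h4).symm
  have hid : ∀ f : M → M, f = id →
      σ (f x) ![mfderiv 𝓘(ℝ, E) 𝓘(ℝ, E) f x a, mfderiv 𝓘(ℝ, E) 𝓘(ℝ, E) f x b] = σ x ![a, b] := by
    rintro _ rfl
    rw [mfderiv_id]
    rfl
  rw [← key t, is_const_of_deriv_eq_zero (fun s ↦ (hconst s).differentiableAt)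
    (fun s ↦ (hconst s).deriv) t 0, key 0]
  exact hid _ (funext hφ.map_zero)

lemma mfderiv_surjective (hφ : IsFlow X φ) (hσ : σ.IsSymplectic)
    (hX : σ.IsHamiltonianPair H X) (t : ℝ) (x : M) :
    Function.Surjective (mfderiv 𝓘(ℝ, E) 𝓘(ℝ, E) (φ t) x : E → E) := by
  have h : ∀ L : E →L[ℝ] E, (∀ a, L a = 0 → a = 0) → Function.Surjective L := fun L hL ↦
    LinearMap.injective_iff_surjective.1 ((injective_iff_map_eq_zero L.toLinearMap).2 hL)
  refine h _ fun a ha ↦ hσ.nondegenerate x a fun b ↦ ?_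
  rw [← hφ.apply_mfderiv_mfderiv hσ hX t x a b]
  exact (σ (φ t x)).map_coord_zero (m := ![_, _]) 0 ha

/-- If `K` is affine along the flow of `X`, that is if `{K, H}` is constant, then the flow preserves
the Hamiltonian vector field of `K`. -/
theorem mfderiv_apply_of_poisson_const (hφ : IsFlow X φ) (hσ : σ.IsSymplectic)
    (hX : σ.IsHamiltonianPair H X) (hY : σ.IsHamiltonianPair K Y)
    (h : ∀ x, σ x ![Y x, X x] = c) (t : ℝ) (x : M) :
    (mfderiv 𝓘(ℝ, E) 𝓘(ℝ, E) (φ t) x (Y x) : E) = Y (φ t x) := by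
  refine hσ.eq_of_forall_apply_eq (x := φ t x) fun b ↦ ?_
  obtain ⟨b', rfl⟩ := hφ.mfderiv_surjective hσ hX t x b
  have hK : MDifferentiable 𝓘(ℝ, E) 𝓘(ℝ, ℝ) K := hY.contMDiff_function.mdifferentiable (by simp)
  have hKφ : K ∘ φ t = fun x ↦ K x + t * c := funext fun x ↦
    hφ.apply_eq_add_mul hK (fun z ↦ (hY.isHamiltonianVectorField z _).trans (h z)) t x
  have h1 := (hK (φ t x)).hasMFDerivAt.comp x
    ((hφ.contMDiff_map hX.contMDiff_field t).mdifferentiableAt (by simp) (x := x)).hasMFDerivAt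
  rw [hKφ] at h1
  have h2 : HasMFDerivAt 𝓘(ℝ, E) 𝓘(ℝ, ℝ) (fun x ↦ K x + t * c) x _ :=
    (hK x).hasMFDerivAt.add (hasMFDerivAt_const (t * c) x)
  have h3 := DFunLike.congr_fun (hasMFDerivAt_unique h1 h2) b'
  have h4 : (mfderiv 𝓘(ℝ, E) 𝓘(ℝ, ℝ) K (φ t x) (mfderiv 𝓘(ℝ, E) 𝓘(ℝ, E) (φ t) x b') : ℝ) =
      mfderiv 𝓘(ℝ, E) 𝓘(ℝ, ℝ) K x b' := h3.trans (add_zero _)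
  refine (hφ.apply_mfderiv_mfderiv hσ hX t x _ _).trans ?_
  exact (hY.isHamiltonianVectorField x b').symm.trans
    (h4.symm.trans (hY.isHamiltonianVectorField (φ t x) _))

/-- If the flow of `X` preserves `Y`, composing the flows of `X` and `Y` gives the flow of
`X + Y`. -/
theorem add (hφ : IsFlow X φ) (hψ : IsFlow Y ψ) (hX : ContMDiff 𝓘(ℝ, E) 𝓘(ℝ, E).tangent ∞
      (fun x ↦ (⟨x, X x⟩ : TangentBundle 𝓘(ℝ, E) M)))
    (h : ∀ t x, (mfderiv 𝓘(ℝ, E) 𝓘(ℝ, E) (φ t) x (Y x) : E) = Y (φ t x)) :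
    IsFlow (X + Y) (fun t x ↦ φ t (ψ t x)) where
  map_zero x := by rw [hψ.map_zero, hφ.map_zero]
  isMIntegralCurve x t := by
    have h1 := ((hφ.contMDiff hX).mdifferentiableAt (by simp) (x := (t, ψ t x))).hasMFDerivAt
    have h2 := h1.comp t ((hasMFDerivAt_id t).prodMk (hψ.isMIntegralCurve x t))
    refine (show HasMFDerivAt 𝓘(ℝ, ℝ) 𝓘(ℝ, E) (fun t ↦ φ t (ψ t x)) t _ from h2).congr_mfderiv ?_
    refine ContinuousLinearMap.ext_ring ?_
    refine (hφ.mfderiv_uncurry_apply hX t (ψ t x) 1 ((1 : ℝ) • (Y (ψ t x) : E))).trans ?_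
    have h3 : (mfderiv 𝓘(ℝ, E) 𝓘(ℝ, E) (φ t) (ψ t x) ((1 : ℝ) • (Y (ψ t x) : E)) : E) =
        Y (φ t (ψ t x)) :=
      (congrArg (mfderiv 𝓘(ℝ, E) 𝓘(ℝ, E) (φ t) (ψ t x)) (one_smul ℝ (Y (ψ t x) : E))).trans
        (h t (ψ t x))
    have h4 : ∀ u v w : E, v = w → (1 : ℝ) • u + v = (1 : ℝ) • (u + w) := by
      rintro u v _ rfl
      rw [one_smul, one_smul]
    exact h4 _ _ _ h3

end IsFlow

end HamiltonianFlow

/-! ### The action of an abelian Lie algebra integrated to a group action -/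

section IntegratedAction

open Set Topology VectorField

variable {E M : Type*} [NormedAddCommGroup E] [NormedSpace ℝ E] [TopologicalSpace M]
  [ChartedSpace E M] [IsManifold 𝓘(ℝ, E) ∞ M] {σ : TwoForm E M} {g : Type*} [NormedLieRing g]
  [NormedLieAlgebra g]

namespace WeaklyHamiltonianAction

variable {ρ : WeaklyHamiltonianAction σ g} {c : LinearMap.BilinForm ℝ g}

variable (ρ) in
lemma isHamiltonianPair (u : g) : σ.IsHamiltonianPair (ρ.hamiltonian u) (ρ.vectorField u) :=
  ⟨ρ.smooth_vectorField u, (ρ.hamiltonian u).contMDiff, ρ.isHamiltonianVectorField u⟩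

variable (ρ) in
lemma vectorField_lie [IsLieAbelian g] (u v : g) :
    mlieBracket 𝓘(ℝ, E) (ρ.vectorField u) (ρ.vectorField v) = 0 := by
  have := ρ.map_lie u v
  rw [trivial_lie_zero, map_zero] at this
  exact neg_eq_zero.1 this.symm

variable (ρ) in
lemma cocycle_eq [IsLieAbelian g] (u v : g) (x : M) :
    ρ.cocycle u v x = σ x ![ρ.vectorField u x, ρ.vectorField v x] := by
  rw [cocycle, trivial_lie_zero, map_zero]
  exact sub_zero _

variable (ρ) in
/-- The pairings of the fundamental vector fields are constant, and hence define an alternating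
bilinear form. -/
theorem exists_bilinForm [FiniteDimensional ℝ E] [ConnectedSpace M] [IsLieAbelian g]
    (hσ : σ.IsSymplectic) :
    ∃ c : LinearMap.BilinForm ℝ g, c.IsAlt ∧
      ∀ u v x, σ x ![ρ.vectorField u x, ρ.vectorField v x] = c u v := by
  obtain ⟨x₀⟩ : Nonempty M := inferInstance
  refine ⟨LinearMap.mk₂ ℝ (fun u v ↦ σ x₀ ![ρ.vectorField u x₀, ρ.vectorField v x₀])
    (fun u u' v ↦ ?_) (fun r u v ↦ ?_) (fun u v v' ↦ ?_) (fun r u v ↦ ?_), fun u ↦ ?_,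
    fun u v x ↦ ?_⟩
  · rw [map_add]
    exact ContinuousAlternatingMap.apply_add_left (E := E) (σ x₀) _ _ _
  · rw [map_smul]
    exact ContinuousAlternatingMap.apply_smul_left (E := E) (σ x₀) _ _ _
  · rw [map_add]
    exact ContinuousAlternatingMap.apply_add_right (E := E) (σ x₀) _ _ _
  · rw [map_smul]
    exact ContinuousAlternatingMap.apply_smul_right (E := E) (σ x₀) _ _ _
  · exact σ.apply_self x₀ _
  · exact hσ.apply_eq_of_mlieBracket_eq_zero (ρ.isHamiltonianPair u) (ρ.isHamiltonianPair v)
      (ρ.vectorField_lie u v) x x₀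

/-- The flow of a fundamental vector field of a complete action. -/
noncomputable def flow (hρ : ρ.IsComplete) (u : g) (t : ℝ) (x : M) : M := (hρ u x).choose t

/-- The time-one flow of a fundamental vector field. For abelian `g` this is the action of the
additive group of `g` which integrates `ρ`. -/
noncomputable def act (hρ : ρ.IsComplete) (u : g) (x : M) : M := flow hρ u 1 x

lemma isFlow (hρ : ρ.IsComplete) (u : g) : IsFlow (ρ.vectorField u) (flow hρ u) :=
  ⟨fun x ↦ (hρ u x).choose_spec.1, fun x ↦ (hρ u x).choose_spec.2⟩

lemma mfderiv_hamiltonian_apply (hc : ∀ u v x, σ x ![ρ.vectorField u x, ρ.vectorField v x] = c u v)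
    (u w : g) (x : M) :
    (mfderiv 𝓘(ℝ, E) 𝓘(ℝ, ℝ) (ρ.hamiltonian w) x (ρ.vectorField u x) : ℝ) = c w u :=
  (ρ.isHamiltonianVectorField w x _).trans (hc w u x)

lemma hamiltonian_act (hρ : ρ.IsComplete)
    (hc : ∀ u v x, σ x ![ρ.vectorField u x, ρ.vectorField v x] = c u v) (u w : g) (x : M) :
    ρ.hamiltonian w (act hρ u x) = ρ.hamiltonian w x + c w u := by
  have := (isFlow hρ u).apply_eq_add_mul ((ρ.hamiltonian w).contMDiff.mdifferentiable (by simp))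
    (mfderiv_hamiltonian_apply hc u w) 1 x
  rwa [one_mul] at this

variable [T2Space M] [FiniteDimensional ℝ E]

lemma flow_eq_act (hρ : ρ.IsComplete) (u : g) (t : ℝ) (x : M) :
    flow hρ u t x = act hρ (t • u) x := by
  have : CompleteSpace E := FiniteDimensional.complete ℝ E
  have h := ((isFlow hρ u).isMIntegralCurve x).comp_mul t
  rw [← map_smul] at h
  have h1 := (isFlow hρ (t • u)).eq_of_isMIntegralCurve (ρ.smooth_vectorField _) h 1
  simpa [act, (isFlow hρ u).map_zero] using h1

lemma act_zero (hρ : ρ.IsComplete) (x : M) : act hρ 0 x = x := by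
  rw [← zero_smul ℝ (0 : g), ← flow_eq_act, (isFlow hρ _).map_zero]

lemma mfderiv_act_vectorField (hσ : σ.IsSymplectic) (hρ : ρ.IsComplete)
    (hc : ∀ u v x, σ x ![ρ.vectorField u x, ρ.vectorField v x] = c u v) (u w : g) (x : M) :
    (mfderiv 𝓘(ℝ, E) 𝓘(ℝ, E) (act hρ u) x (ρ.vectorField w x) : E) =
      ρ.vectorField w (act hρ u x) :=
  (isFlow hρ u).mfderiv_apply_of_poisson_const hσ (ρ.isHamiltonianPair u)
    (ρ.isHamiltonianPair w) (hc w u) 1 x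

lemma apply_mfderiv_act (hσ : σ.IsSymplectic) (hρ : ρ.IsComplete) (u : g) (x : M)
    (a b : TangentSpace 𝓘(ℝ, E) x) :
    σ (act hρ u x) ![mfderiv 𝓘(ℝ, E) 𝓘(ℝ, E) (act hρ u) x a,
      mfderiv 𝓘(ℝ, E) 𝓘(ℝ, E) (act hρ u) x b] = σ x ![a, b] :=
  (isFlow hρ u).apply_mfderiv_mfderiv hσ (ρ.isHamiltonianPair u) 1 x a b

lemma act_add (hσ : σ.IsSymplectic) (hρ : ρ.IsComplete)
    (hc : ∀ u v x, σ x ![ρ.vectorField u x, ρ.vectorField v x] = c u v) (u w : g) (x : M) :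
    act hρ (u + w) x = act hρ u (act hρ w x) := by
  have : CompleteSpace E := FiniteDimensional.complete ℝ E
  have h := (isFlow hρ u).add (isFlow hρ w) (ρ.smooth_vectorField u) fun t x ↦
    (isFlow hρ u).mfderiv_apply_of_poisson_const hσ (ρ.isHamiltonianPair u)
      (ρ.isHamiltonianPair w) (hc w u) t x
  rw [← map_add] at h
  have h1 := (isFlow hρ (u + w)).eq_of_isMIntegralCurve (ρ.smooth_vectorField _)
    (h.isMIntegralCurve x) 1
  simp only [(isFlow hρ _).map_zero] at h1
  exact h1.symm

/-- The integrated action is jointly smooth: in coordinates with respect to a basis it is a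
composition of flows. -/
theorem contMDiff_act_uncurry [FiniteDimensional ℝ g] (hσ : σ.IsSymplectic) (hρ : ρ.IsComplete)
    (hc : ∀ u v x, σ x ![ρ.vectorField u x, ρ.vectorField v x] = c u v) :
    ContMDiff (𝓘(ℝ, g).prod 𝓘(ℝ, E)) 𝓘(ℝ, E) ∞ (fun p : g × M ↦ act hρ p.1 p.2) := by
  set b := Module.finBasis ℝ g with hb
  have h : ∀ s : Finset (Fin (Module.finrank ℝ g)), ContMDiff (𝓘(ℝ, g).prod 𝓘(ℝ, E)) 𝓘(ℝ, E) ∞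
      (fun p : g × M ↦ act hρ (∑ i ∈ s, b.repr p.1 i • b i) p.2) := by
    intro s
    induction s using Finset.induction_on with
    | empty =>
      simp only [Finset.sum_empty, act_zero]
      exact contMDiff_snd
    | insert i s hi ih =>
      have h1 : ContMDiff (𝓘(ℝ, g).prod 𝓘(ℝ, E)) 𝓘(ℝ, ℝ) ∞ fun p : g × M ↦ b.repr p.1 i :=
        (b.coord i).toContinuousLinearMap.contDiff.contMDiff.comp contMDiff_fst
      simp only [Finset.sum_insert hi, act_add hσ hρ hc, ← flow_eq_act]
      exact ((isFlow hρ (b i)).contMDiff (ρ.smooth_vectorField _)).comp (h1.prodMk ih)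
  simpa only [b.sum_repr] using h Finset.univ

lemma mfderiv_act_uncurry_apply [FiniteDimensional ℝ g] (hσ : σ.IsSymplectic) (hρ : ρ.IsComplete)
    (hc : ∀ u v x, σ x ![ρ.vectorField u x, ρ.vectorField v x] = c u v) (u : g) (x : M) (w : g)
    (a : E) :
    (mfderiv (𝓘(ℝ, g).prod 𝓘(ℝ, E)) 𝓘(ℝ, E) (fun p : g × M ↦ act hρ p.1 p.2) (u, x) (w, a) : E) =
      (ρ.vectorField w (act hρ u x) : E) + mfderiv 𝓘(ℝ, E) 𝓘(ℝ, E) (act hρ u) x a := by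
  have hA := contMDiff_act_uncurry hσ hρ hc
  refine (mfderiv_prod_eq_add_apply (hA.mdifferentiableAt (by simp))).trans ?_
  refine congrArg₂ (fun z z' : E ↦ z + z') ?_ rfl
  have h1 : MDifferentiableAt 𝓘(ℝ, g) 𝓘(ℝ, E) (fun z ↦ act hρ z x) u :=
    (hA.comp (contMDiff_id.prodMk contMDiff_const)).mdifferentiableAt (by simp)
  have h2 : HasFDerivAt (fun t : ℝ ↦ t • w + u) ((1 : ℝ →L[ℝ] ℝ).smulRight w) 0 :=
    ((1 : ℝ →L[ℝ] ℝ).smulRight w).hasFDerivAt.add_const u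
  have h3 : HasMFDerivAt 𝓘(ℝ, g) 𝓘(ℝ, E) (fun z ↦ act hρ z x) ((0 : ℝ) • w + u) _ :=
    MDifferentiableAt.hasMFDerivAt (by rwa [zero_smul, zero_add])
  have h4 := h3.comp (0 : ℝ) h2.hasMFDerivAt
  have h5 : (fun z ↦ act hρ z x) ∘ (fun t : ℝ ↦ t • w + u) =
      fun t ↦ flow hρ w t (act hρ u x) := by
    ext t
    rw [Function.comp_apply, act_add hσ hρ hc, flow_eq_act]
  rw [h5] at h4
  have h6 := hasMFDerivAt_unique h4 ((isFlow hρ w).isMIntegralCurve (act hρ u x) 0)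
  have h7 : (mfderiv 𝓘(ℝ, g) 𝓘(ℝ, E) (fun z ↦ act hρ z x) ((0 : ℝ) • w + u) ((1 : ℝ) • w) : E) =
      (1 : ℝ) • (ρ.vectorField w (flow hρ w 0 (act hρ u x)) : E) :=
    congrArg (fun L : ℝ →L[ℝ] E ↦ L 1) h6
  rw [one_smul, one_smul, zero_smul, zero_add, (isFlow hρ w).map_zero] at h7
  exact h7

end WeaklyHamiltonianAction

end IntegratedAction

/-! ### The symplectic complement of the kernel of the cocycle -/

section BilinForm

variable {g : Type*} [AddCommGroup g] [Module ℝ g] {c : LinearMap.BilinForm ℝ g}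
  {V : Submodule ℝ g}

lemma LinearMap.BilinForm.apply_projectionOnto_left (hV : IsCompl V (LinearMap.ker c))
    (u w : g) :
    c (V.projectionOnto (LinearMap.ker c) hV u) w = c u w := by
  have h : V.projectionOnto (LinearMap.ker c) hV
      (u - V.projectionOnto (LinearMap.ker c) hV u) = 0 := by
    rw [map_sub, Submodule.projectionOnto_apply_left, sub_self]
  have h1 := LinearMap.mem_ker.1 ((Submodule.projectionOnto_apply_eq_zero_iff hV).1 h)
  rw [map_sub, sub_eq_zero] at h1
  rw [← h1]

lemma LinearMap.BilinForm.IsAlt.apply_projectionOnto_right (hc : c.IsAlt)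
    (hV : IsCompl V (LinearMap.ker c)) (w u : g) :
    c w (V.projectionOnto (LinearMap.ker c) hV u) = c w u := by
  rw [← neg_inj, hc.neg_eq, hc.neg_eq, apply_projectionOnto_left]

lemma LinearMap.BilinForm.IsAlt.restrict_nondegenerate (hc : c.IsAlt)
    (hV : IsCompl V (LinearMap.ker c)) :
    (LinearMap.BilinForm.restrict c V).Nondegenerate := by
  have hr : (LinearMap.BilinForm.restrict c V).IsRefl := fun v w h ↦ hc.isRefl v w h
  refine hr.nondegenerate_iff_separatingLeft.2 fun v hv ↦ ?_
  have h : (v : g) ∈ LinearMap.ker c := by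
    refine LinearMap.mem_ker.2 (LinearMap.ext fun w ↦ ?_)
    rw [← hc.apply_projectionOnto_right hV]
    exact hv _
  exact Subtype.ext ((Submodule.disjoint_def.1 hV.disjoint) v v.2 h)

lemma LinearMap.BilinForm.IsAlt.eq_of_forall_apply_eq (hc : c.IsAlt)
    (hV : IsCompl V (LinearMap.ker c)) {v v' : V} (h : ∀ w ∈ V, c w v = c w v') : v = v' :=
  sub_eq_zero.1 ((hc.restrict_nondegenerate hV).2 (v - v') fun w ↦ by
    change c w ((v : g) - v') = 0
    rw [map_sub, h w w.2, sub_self])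

end BilinForm

/-! ### The splitting of the ambient manifold -/

section Splitting

open Set Topology VectorField

variable {E M : Type*} [NormedAddCommGroup E] [NormedSpace ℝ E] [TopologicalSpace M]
  [ChartedSpace E M] [IsManifold 𝓘(ℝ, E) ∞ M] {σ : TwoForm E M} {g : Type*} [NormedLieRing g]
  [NormedLieAlgebra g] {ρ : WeaklyHamiltonianAction σ g} {c : LinearMap.BilinForm ℝ g}
  {V : Submodule ℝ g}

variable (E) in
/-- The derivative of a map between manifolds modelled on vector spaces, as a linear map between the
model spaces, with which the tangent spaces are identified. -/
noncomputable def modelDeriv (F : Type*) [NormedAddCommGroup F] [NormedSpace ℝ F] {N : Type*}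
    [TopologicalSpace N] [ChartedSpace F N] (f : M → N) (x : M) : E →L[ℝ] F :=
  mfderiv 𝓘(ℝ, E) 𝓘(ℝ, F) f x

/-- A 2-form at a point, as an alternating form on the model space. -/
def TwoForm.modelForm (σ : TwoForm E M) (x : M) : E [⋀^Fin 2]→L[ℝ] ℝ := σ x

namespace WeaklyHamiltonianAction

variable (ρ) in
/-- The value of a fundamental vector field, as an element of the model space. -/
noncomputable def fieldAt (u : g) (x : M) : E := ρ.vectorField u x

variable (ρ) in
lemma fieldAt_add (u w : g) (x : M) : ρ.fieldAt (u + w) x = ρ.fieldAt u x + ρ.fieldAt w x :=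
  congrFun (ρ.vectorField.map_add u w) x

variable (ρ c) in
/-- A smooth map `h` to `V` which encodes the Hamiltonian functions `H_w`, `w ∈ V`, by means of
the form `c`. It is the `V`-component of the splitting. -/
structure IsMomentumMap (h : M → V) : Prop where
  contMDiff : ContMDiff 𝓘(ℝ, E) 𝓘(ℝ, V) ∞ h
  apply_eq : ∀ w ∈ V, ∀ x, c w (h x) = ρ.hamiltonian w x

variable (ρ) in
lemma exists_isMomentumMap [FiniteDimensional ℝ g] (hcA : c.IsAlt)
    (hV : IsCompl V (LinearMap.ker c)) : ∃ h : M → V, ρ.IsMomentumMap c h := by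
  have hN := hcA.restrict_nondegenerate hV
  set b := Module.finBasis ℝ V
  -- the basis of `V` with `c w (d i)` the `i`-th coordinate of `w`
  set d : Fin (Module.finrank ℝ V) → V := fun i ↦
    -((LinearMap.BilinForm.toDual _ hN).symm (b.coord i)) with hd
  have hcd : ∀ (w : V) i, c w (d i) = b.coord i w := by
    intro w i
    have h1 : LinearMap.BilinForm.restrict c V
        ((LinearMap.BilinForm.toDual _ hN).symm (b.coord i)) w = b.coord i w := by
      rw [LinearMap.BilinForm.apply_toDual_symm_apply]
    rw [← h1]
    change c w (-(_ : g)) = c _ _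
    rw [map_neg, hcA.neg_eq]
    rfl
  refine ⟨fun x ↦ ∑ i, ρ.hamiltonian (b i) x • d i, ?_, fun w hw x ↦ ?_⟩
  · refine contMDiff_finsetSum fun i _ ↦ ?_
    exact (ρ.hamiltonian (b i)).contMDiff.smul contMDiff_const
  · have h1 : (w : g) = ∑ i, b.coord i ⟨w, hw⟩ • (b i : g) := by
      have := congrArg V.subtype (b.sum_repr ⟨w, hw⟩).symm
      rw [map_sum] at this
      exact this
    have h2 : ρ.hamiltonian w x = ∑ i, b.coord i ⟨w, hw⟩ * ρ.hamiltonian (b i) x := by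
      let l : g →ₗ[ℝ] ℝ := ⟨⟨fun u ↦ ρ.hamiltonian u x,
        fun u v ↦ DFunLike.congr_fun (map_add ρ.hamiltonian u v) x⟩,
        fun r u ↦ DFunLike.congr_fun (map_smul ρ.hamiltonian r u) x⟩
      change l w = ∑ i, b.coord i ⟨w, hw⟩ * l (b i)
      conv_lhs => rw [h1, map_sum]
      exact Finset.sum_congr rfl fun i _ ↦ map_smul l _ _
    rw [h2]
    simp only [Submodule.coe_sum, Submodule.coe_smul, map_sum, map_smul, smul_eq_mul]
    exact Finset.sum_congr rfl fun i _ ↦ by rw [mul_comm, ← hcd ⟨w, hw⟩ i]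

/-- The map which moves every point to the common zero level of the `H_w`, `w ∈ V`, by the
translation with `-h`. -/
noncomputable def retract (hρ : ρ.IsComplete) (h : M → V) (x : M) : M := act hρ (-(h x : g)) x

lemma retract_of_eq_zero [T2Space M] [FiniteDimensional ℝ E]
    (hρ : ρ.IsComplete) {h : M → V} {x : M} (hx : h x = 0) :
    retract hρ h x = x := by
  rw [retract, hx, Submodule.coe_zero, neg_zero, act_zero]

lemma act_retract [T2Space M] [FiniteDimensional ℝ E] (hσ : σ.IsSymplectic)
    (hρ : ρ.IsComplete) {h : M → V}
    (hc : ∀ u v x, σ x ![ρ.vectorField u x, ρ.vectorField v x] = c u v) (x : M) :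
    act hρ (h x : g) (retract hρ h x) = x := by
  rw [retract, ← act_add hσ hρ hc, add_neg_cancel, act_zero]

namespace IsMomentumMap

variable {h : M → V}

lemma mem_zeroLevel_iff (hh : ρ.IsMomentumMap c h) (hcA : c.IsAlt)
    (hV : IsCompl V (LinearMap.ker c)) (x : M) : x ∈ ρ.zeroLevel V ↔ h x = 0 := by
  refine ⟨fun hx ↦ hcA.eq_of_forall_apply_eq hV fun w hw ↦ ?_, fun hx w hw ↦ ?_⟩
  · rw [hh.apply_eq w hw, hx w hw, Submodule.coe_zero, map_zero]
  · rw [← hh.apply_eq w hw, hx, Submodule.coe_zero, map_zero]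

lemma apply_act (hh : ρ.IsMomentumMap c h) (hρ : ρ.IsComplete)
    (hc : ∀ u v x, σ x ![ρ.vectorField u x, ρ.vectorField v x] = c u v) (hcA : c.IsAlt)
    (hV : IsCompl V (LinearMap.ker c)) (u : g) (x : M) :
    h (act hρ u x) = h x + V.projectionOnto (LinearMap.ker c) hV u := by
  refine hcA.eq_of_forall_apply_eq hV fun w hw ↦ ?_
  rw [hh.apply_eq w hw, hamiltonian_act hρ hc, Submodule.coe_add, map_add, hh.apply_eq w hw,
    hcA.apply_projectionOnto_right]

lemma apply_retract (hh : ρ.IsMomentumMap c h) (hρ : ρ.IsComplete)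
    (hc : ∀ u v x, σ x ![ρ.vectorField u x, ρ.vectorField v x] = c u v) (hcA : c.IsAlt)
    (hV : IsCompl V (LinearMap.ker c)) (x : M) : h (retract hρ h x) = 0 := by
  rw [retract, hh.apply_act hρ hc hcA hV, map_neg, Submodule.projectionOnto_apply_left,
    add_neg_cancel]

lemma apply_mfderiv [FiniteDimensional ℝ g] (hh : ρ.IsMomentumMap c h) {w : g} (hw : w ∈ V) (x : M)
    (a : E) :
    c w (modelDeriv E V h x a) = σ.modelForm x ![ρ.fieldAt w x, a] := by
  set L : V →L[ℝ] ℝ := ((c w).comp V.subtype).toContinuousLinearMap with hL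
  have h1 : L.toFun ∘ h = ρ.hamiltonian w := funext fun x ↦ hh.apply_eq w hw x
  have h2 := L.hasFDerivAt.hasMFDerivAt.comp x
    (hh.contMDiff.mdifferentiableAt (by simp) (x := x)).hasMFDerivAt
  have h3 := (h1 ▸ h2 : HasMFDerivAt 𝓘(ℝ, E) 𝓘(ℝ, ℝ) (ρ.hamiltonian w) x _).mfderiv
  exact (congrArg (fun L : E →L[ℝ] ℝ ↦ L a) h3).symm.trans (ρ.isHamiltonianVectorField w x a)

lemma mfderiv_vectorField [FiniteDimensional ℝ g] (hh : ρ.IsMomentumMap c h)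
    (hc : ∀ u v x, σ x ![ρ.vectorField u x, ρ.vectorField v x] = c u v) (hcA : c.IsAlt)
    (hV : IsCompl V (LinearMap.ker c)) (u : g) (x : M) :
    modelDeriv E V h x (ρ.fieldAt u x) =
      V.projectionOnto (LinearMap.ker c) hV u := by
  refine hcA.eq_of_forall_apply_eq hV fun w hw ↦ ?_
  rw [hh.apply_mfderiv hw, hcA.apply_projectionOnto_right]
  exact hc w u x

lemma mfderiv_surjective [FiniteDimensional ℝ g] (hh : ρ.IsMomentumMap c h)
    (hc : ∀ u v x, σ x ![ρ.vectorField u x, ρ.vectorField v x] = c u v) (hcA : c.IsAlt)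
    (hV : IsCompl V (LinearMap.ker c)) (x : M) :
    Function.Surjective (modelDeriv E V h x) := fun v ↦
  ⟨ρ.fieldAt (v : V) x, (hh.mfderiv_vectorField hc hcA hV _ x).trans
    (Submodule.projectionOnto_apply_left hV v)⟩

/-- Vectors tangent to the zero level pair to zero with the `X_w`, `w ∈ V`. -/
lemma apply_eq_zero [FiniteDimensional ℝ g] (hh : ρ.IsMomentumMap c h) {w : g} (hw : w ∈ V) {x : M}
    {a : E} (ha : (modelDeriv E V h x a) = 0) :
    σ.modelForm x ![ρ.fieldAt w x, a] = 0 := by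
  rw [← hh.apply_mfderiv hw, ha, Submodule.coe_zero, map_zero]

lemma contMDiff_coe (hh : ρ.IsMomentumMap c h) :
    ContMDiff 𝓘(ℝ, E) 𝓘(ℝ, g) ∞ (fun x ↦ (h x : g)) :=
  V.subtypeL.contDiff.contMDiff.comp hh.contMDiff

lemma hasMFDerivAt_coe (hh : ρ.IsMomentumMap c h) (x : M) :
    HasMFDerivAt 𝓘(ℝ, E) 𝓘(ℝ, g) (fun x ↦ (h x : g)) x
      (V.subtypeL.comp (modelDeriv E V h x : E →L[ℝ] V)) :=
  V.subtypeL.hasFDerivAt.hasMFDerivAt.comp x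
    (hh.contMDiff.mdifferentiableAt (by simp) (x := x)).hasMFDerivAt

variable [T2Space M] [FiniteDimensional ℝ E] [FiniteDimensional ℝ g]

lemma contMDiff_retract (hh : ρ.IsMomentumMap c h) (hσ : σ.IsSymplectic) (hρ : ρ.IsComplete)
    (hc : ∀ u v x, σ x ![ρ.vectorField u x, ρ.vectorField v x] = c u v) :
    ContMDiff 𝓘(ℝ, E) 𝓘(ℝ, E) ∞ (retract hρ h) :=
  (contMDiff_act_uncurry hσ hρ hc).comp (hh.contMDiff_coe.neg.prodMk contMDiff_id)

lemma mfderiv_retract (hh : ρ.IsMomentumMap c h) (hσ : σ.IsSymplectic) (hρ : ρ.IsComplete)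
    (hc : ∀ u v x, σ x ![ρ.vectorField u x, ρ.vectorField v x] = c u v) (x : M) (a : E) :
    modelDeriv E E (retract hρ h) x a =
      ρ.fieldAt (-(modelDeriv E V h x a : g)) (retract hρ h x) +
        modelDeriv E E (act hρ (-(h x : g))) x a := by
  have h1 := ((contMDiff_act_uncurry hσ hρ hc).mdifferentiableAt (by simp)
    (x := (-(h x : g), x))).hasMFDerivAt
  have h0 : HasMFDerivAt 𝓘(ℝ, E) 𝓘(ℝ, g) (fun x ↦ -(h x : g)) x
      (-(V.subtypeL.comp (modelDeriv E V h x))) := (hh.hasMFDerivAt_coe x).neg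
  have h2 := HasMFDerivAt.comp (f := fun x ↦ (-(h x : g), x)) x h1
    (h0.prodMk (hasMFDerivAt_id x))
  have h3 := (show HasMFDerivAt 𝓘(ℝ, E) 𝓘(ℝ, E) (retract hρ h) x _ from h2).mfderiv
  exact (congrArg (fun L : E →L[ℝ] E ↦ L a) h3).trans
    (mfderiv_act_uncurry_apply hσ hρ hc (-(h x : g)) x (-(modelDeriv E V h x a : g)) a)

lemma mfderiv_retract_vectorField (hh : ρ.IsMomentumMap c h) (hσ : σ.IsSymplectic)
    (hρ : ρ.IsComplete) (hc : ∀ u v x, σ x ![ρ.vectorField u x, ρ.vectorField v x] = c u v)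
    (hcA : c.IsAlt) (hV : IsCompl V (LinearMap.ker c)) (u : g) (x : M) :
    modelDeriv E E (retract hρ h) x (ρ.fieldAt u x) =
      ρ.fieldAt (u - V.projectionOnto (LinearMap.ker c) hV u) (retract hρ h x) := by
  rw [sub_eq_neg_add, fieldAt_add]
  refine (hh.mfderiv_retract hσ hρ hc x _).trans (congrArg₂ (fun z z' : E ↦ z + z') ?_ ?_)
  · rw [hh.mfderiv_vectorField hc hcA hV]
  · exact mfderiv_act_vectorField hσ hρ hc _ u x

lemma mfderiv_apply_mfderiv_retract (hh : ρ.IsMomentumMap c h) (hσ : σ.IsSymplectic)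
    (hρ : ρ.IsComplete) (hc : ∀ u v x, σ x ![ρ.vectorField u x, ρ.vectorField v x] = c u v)
    (hcA : c.IsAlt) (hV : IsCompl V (LinearMap.ker c)) (x : M) (a : E) :
    modelDeriv E V h (retract hρ h x) (modelDeriv E E (retract hρ h) x a) = 0 := by
  have h1 := (hh.contMDiff.mdifferentiableAt (by simp) (x := retract hρ h x)).hasMFDerivAt.comp x
    ((hh.contMDiff_retract hσ hρ hc).mdifferentiableAt (by simp) (x := x)).hasMFDerivAt
  rw [show h ∘ retract hρ h = fun _ ↦ 0 from funext (hh.apply_retract hρ hc hcA hV)] at h1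
  exact congrArg (fun L : E →L[ℝ] V ↦ L a) (hasMFDerivAt_unique h1 (hasMFDerivAt_const 0 x))

/-- Every tangent vector is the sum of some `X_w`, `w ∈ V`, and the translate of a vector tangent to
the zero level. -/
lemma eq_vectorField_add (hh : ρ.IsMomentumMap c h) (hσ : σ.IsSymplectic)
    (hρ : ρ.IsComplete) (hc : ∀ u v x, σ x ![ρ.vectorField u x, ρ.vectorField v x] = c u v)
    (x : M) (a : E) :
    a = (ρ.fieldAt (modelDeriv E V h x a) x) +
      (modelDeriv E E (act hρ (h x : g)) (retract hρ h x)
        (modelDeriv E E (retract hρ h) x a)) := by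
  have h1 := ((contMDiff_act_uncurry hσ hρ hc).mdifferentiableAt (by simp)
    (x := ((h x : g), retract hρ h x))).hasMFDerivAt
  have h2 := h1.comp x ((hh.hasMFDerivAt_coe x).prodMk
    ((hh.contMDiff_retract hσ hρ hc).mdifferentiableAt (by simp) (x := x)).hasMFDerivAt)
  rw [show (fun p : g × M ↦ act hρ p.1 p.2) ∘ (fun x ↦ ((h x : g), retract hρ h x)) = id from
    funext (act_retract hσ hρ hc)] at h2
  have h3 := congrArg (fun L : E →L[ℝ] E ↦ L a) (hasMFDerivAt_unique h2 (hasMFDerivAt_id x))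
  refine h3.symm.trans ((mfderiv_act_uncurry_apply hσ hρ hc _ _ _ _).trans ?_)
  refine congrArg₂ (fun z z' : E ↦ z + z') ?_ rfl
  exact congrArg (fun y ↦ (ρ.fieldAt (modelDeriv E V h x a : g) y))
    (act_retract hσ hρ hc x)

/-- The symplectic form splits along the map `(h, retract h)`. -/
theorem apply_eq_add (hh : ρ.IsMomentumMap c h) (hσ : σ.IsSymplectic)
    (hρ : ρ.IsComplete) (hc : ∀ u v x, σ x ![ρ.vectorField u x, ρ.vectorField v x] = c u v)
    (hcA : c.IsAlt) (hV : IsCompl V (LinearMap.ker c)) (x : M) (a b : E) :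
    σ.modelForm x ![a, b] = c (modelDeriv E V h x a) (modelDeriv E V h x b) +
      σ.modelForm (retract hρ h x) ![modelDeriv E E (retract hρ h) x a,
        modelDeriv E E (retract hρ h) x b] := by
  set v : V := modelDeriv E V h x a with hv
  set w : V := modelDeriv E V h x b with hw
  set T : E →L[ℝ] E := modelDeriv E E (act hρ (h x : g)) (retract hρ h x) with hT
  set a' : E := modelDeriv E E (retract hρ h) x a with ha'
  set b' : E := modelDeriv E E (retract hρ h) x b with hb'
  have ha : a = (ρ.fieldAt v x) + T a' := hh.eq_vectorField_add hσ hρ hc x a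
  have hb : b = (ρ.fieldAt w x) + T b' := hh.eq_vectorField_add hσ hρ hc x b
  have hx := act_retract (h := h) hσ hρ hc x
  have hTT : ∀ a b : E, σ.modelForm x ![T a, T b] =
      σ.modelForm (retract hρ h x) ![a, b] := fun a b ↦
    (σ.apply_congr hx.symm _ _).trans (apply_mfderiv_act hσ hρ _ _ a b)
  -- the mixed terms vanish, since translations preserve the `X_v`
  have hmix : ∀ (v : V) (b : E), σ.modelForm x ![ρ.fieldAt v x,
      T (modelDeriv E E (retract hρ h) x b)] = 0 := by
    intro v b
    have h1 : ρ.fieldAt v x = T (ρ.fieldAt v (retract hρ h x)) := by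
      refine Eq.symm ((mfderiv_act_vectorField hσ hρ hc _ _ _).trans ?_)
      exact congrArg (fun y ↦ (ρ.fieldAt (v : g) y)) hx
    rw [h1, hTT]
    exact hh.apply_eq_zero v.2 (hh.mfderiv_apply_mfderiv_retract hσ hρ hc hcA hV x b)
  have hvw : σ.modelForm x ![ρ.fieldAt v x, ρ.fieldAt w x] =
    c v w := hc v w x
  have hcalc : σ.modelForm x ![a, b] =
      c v w + σ.modelForm (retract hρ h x) ![a', b'] := by
    rw [ha, hb, ContinuousAlternatingMap.apply_add_left, ContinuousAlternatingMap.apply_add_right,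
      ContinuousAlternatingMap.apply_add_right, hvw, hmix v b,
      ContinuousAlternatingMap.apply_swap _ (T a'), hmix w a, hTT]
    ring
  exact hcalc

end IsMomentumMap

end WeaklyHamiltonianAction

end Splitting

/-! ### Symplectic reduction of the action to the zero level -/

section Reduction

open Set Topology VectorField

section ModelDeriv

variable {E M F N F' N' : Type*} [NormedAddCommGroup E] [NormedSpace ℝ E] [TopologicalSpace M]
  [ChartedSpace E M] [NormedAddCommGroup F] [NormedSpace ℝ F] [TopologicalSpace N]
  [ChartedSpace F N] [NormedAddCommGroup F'] [NormedSpace ℝ F'] [TopologicalSpace N']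
  [ChartedSpace F' N']

lemma modelDeriv_comp {f : M → N} {f' : N → N'} {x : M}
    (hf' : MDifferentiableAt 𝓘(ℝ, F) 𝓘(ℝ, F') f' (f x))
    (hf : MDifferentiableAt 𝓘(ℝ, E) 𝓘(ℝ, F) f x) (a : E) :
    modelDeriv E F' (f' ∘ f) x a = modelDeriv F F' f' (f x) (modelDeriv E F f x a) :=
  mfderiv_comp_apply x hf' hf a

lemma modelDeriv_id (x : M) (a : E) : modelDeriv E E (id : M → M) x a = a :=
  DFunLike.congr_fun (mfderiv_id (I := 𝓘(ℝ, E))) a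

lemma TwoForm.modelForm_pullback (σ : TwoForm E M) (f : N → M) (n : N) (a b : F) :
    (σ.pullback (F := F) f).modelForm n ![a, b] =
      σ.modelForm (f n) ![modelDeriv F E f n a, modelDeriv F E f n b] :=
  TwoForm.pullback_apply σ f n a b

/-- The pullback of a symplectic form under a smooth map is smooth and closed, so that it is
symplectic as soon as it is nondegenerate. -/
theorem TwoForm.IsSymplectic.pullback [IsManifold 𝓘(ℝ, E) ∞ M] [IsManifold 𝓘(ℝ, F) ∞ N]
    [FiniteDimensional ℝ F] {σ : TwoForm E M} (hσ : σ.IsSymplectic) {f : N → M}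
    (hf : ContMDiff 𝓘(ℝ, F) 𝓘(ℝ, E) ∞ f)
    (hn : ∀ n (a : F), (∀ b, (σ.pullback (F := F) f).modelForm n ![a, b] = 0) → a = 0) :
    (σ.pullback (F := F) f).IsSymplectic := by
  have key : ∀ n₀ : N, ContDiffOn ℝ ∞ ((σ.pullback (F := F) f).inChart n₀)
      (extChartAt 𝓘(ℝ, F) n₀).target ∧ ∀ y ∈ (extChartAt 𝓘(ℝ, F) n₀).target,
        extDeriv ((σ.pullback (F := F) f).inChart n₀) y = 0 := by
    intro n₀
    have ho := isOpen_extChartAt_target (I := 𝓘(ℝ, F)) n₀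
    obtain ⟨h1, h2⟩ := hσ.pullback_flat (g := f ∘ (extChartAt 𝓘(ℝ, F) n₀).symm) ho
      (hf.comp_contMDiffOn (contMDiffOn_extChartAt_symm n₀)) rfl
    have heq : EqOn ((σ.pullback (F := F) f).inChart n₀)
        (σ.pullback (F := F) (f ∘ (extChartAt 𝓘(ℝ, F) n₀).symm))
        (extChartAt 𝓘(ℝ, F) n₀).target := by
      intro y hy
      ext v
      have h3 := mfderiv_comp y (hf.mdifferentiableAt (by simp))
        ((contMDiffAt_extChartAt_symm hy).mdifferentiableAt (by simp))
      exact (congrArg (fun L : F →L[ℝ] E ↦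
        (σ (f ((extChartAt 𝓘(ℝ, F) n₀).symm y)) : E [⋀^Fin 2]→L[ℝ] ℝ) (L ∘ v)) h3).symm
    exact ⟨h1.congr heq, fun y hy ↦
      (Filter.eventuallyEq_of_mem (ho.mem_nhds hy) heq).extDeriv_eq.trans (h2 y hy)⟩
  exact ⟨fun n₀ ↦ (key n₀).1, fun n₀ ↦ (key n₀).2, hn⟩

end ModelDeriv

namespace WeaklyHamiltonianAction

variable {E M : Type*} [NormedAddCommGroup E] [NormedSpace ℝ E] [TopologicalSpace M]
  [ChartedSpace E M] [IsManifold 𝓘(ℝ, E) ∞ M] {σ : TwoForm E M} {g : Type*} [NormedLieRing g]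
  [NormedLieAlgebra g] {ρ : WeaklyHamiltonianAction σ g} {c : LinearMap.BilinForm ℝ g}
  {V : Submodule ℝ g} {F N : Type*} [NormedAddCommGroup F] [NormedSpace ℝ F] [TopologicalSpace N]
  [ChartedSpace F N] {h : M → V} {ι : N → M} {r : M → N}

variable (F c) in
/-- `N`, with the inclusion `ι` and the projection `r`, is the zero level of the momentum map `h` of
the symplectic manifold `M`, together with the retraction of `M` by translations. -/
structure IsReduction (hρ : ρ.IsComplete) (h : M → V) (ι : N → M) (r : M → N) : Prop where
  isSymplectic : σ.IsSymplectic
  apply_eq : ∀ u v x, σ x ![ρ.vectorField u x, ρ.vectorField v x] = c u v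
  isAlt : c.IsAlt
  isCompl : IsCompl V (LinearMap.ker c)
  isMomentumMap : ρ.IsMomentumMap c h
  contMDiff_incl : ContMDiff 𝓘(ℝ, F) 𝓘(ℝ, E) ∞ ι
  contMDiff_proj : ContMDiff 𝓘(ℝ, E) 𝓘(ℝ, F) ∞ r
  incl_proj : ∀ x, ι (r x) = retract hρ h x
  proj_incl : ∀ n, r (ι n) = n

namespace IsReduction

variable {hρ : ρ.IsComplete}

lemma apply_incl (R : IsReduction c F hρ h ι r) (n : N) : h (ι n) = 0 := by
  rw [← R.proj_incl n, R.incl_proj]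
  exact R.isMomentumMap.apply_retract hρ R.apply_eq R.isAlt R.isCompl _

lemma mdifferentiableAt_incl (R : IsReduction c F hρ h ι r) (n : N) :
    MDifferentiableAt 𝓘(ℝ, F) 𝓘(ℝ, E) ι n := R.contMDiff_incl.mdifferentiableAt (by simp)

lemma mdifferentiableAt_proj (R : IsReduction c F hρ h ι r) (x : M) :
    MDifferentiableAt 𝓘(ℝ, E) 𝓘(ℝ, F) r x := R.contMDiff_proj.mdifferentiableAt (by simp)

lemma contMDiff_field [IsManifold 𝓘(ℝ, F) ∞ N] (R : IsReduction c F hρ h ι r) (u : g) :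
    ContMDiff 𝓘(ℝ, F) 𝓘(ℝ, F).tangent ∞
      (fun n ↦ (⟨n, modelDeriv E F r (ι n) (ρ.fieldAt u (ι n))⟩ : TangentBundle 𝓘(ℝ, F) N)) := by
  have h1 := (R.contMDiff_proj.contMDiff_tangentMap (m := ∞) (by simp)).comp
    ((ρ.smooth_vectorField u).comp R.contMDiff_incl)
  have h2 : ∀ n n' : N, n' = n → ∀ a : F, (⟨n, a⟩ : TangentBundle 𝓘(ℝ, F) N) = ⟨n', a⟩ := by
    rintro n _ rfl a
    rfl
  exact h1.congr fun n ↦ h2 _ _ (R.proj_incl n) _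

lemma hamiltonian_eq_add [T2Space M] [FiniteDimensional ℝ E] (R : IsReduction c F hρ h ι r)
    (u : g) (x : M) :
    ρ.hamiltonian u x = c (V.projectionOnto (LinearMap.ker c) R.isCompl u) (h x) +
      ρ.hamiltonian u (ι (r x)) := by
  have h1 := hamiltonian_act hρ R.apply_eq (h x) u (retract hρ h x)
  rw [act_retract R.isSymplectic hρ R.apply_eq] at h1
  rw [h1, R.incl_proj, LinearMap.BilinForm.apply_projectionOnto_left, add_comm]

lemma modelDeriv_proj_incl (R : IsReduction c F hρ h ι r) (n : N) (a : F) :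
    modelDeriv E F r (ι n) (modelDeriv F E ι n a) = a := by
  rw [← modelDeriv_comp (R.mdifferentiableAt_proj _) (R.mdifferentiableAt_incl n),
    show r ∘ ι = id from funext R.proj_incl, modelDeriv_id]

lemma modelDeriv_incl_injective (R : IsReduction c F hρ h ι r) (n : N) :
    Function.Injective (modelDeriv F E ι n) :=
  Function.LeftInverse.injective (R.modelDeriv_proj_incl n)

lemma modelDeriv_incl_proj (R : IsReduction c F hρ h ι r) (x : M) (a : E) :
    modelDeriv F E ι (r x) (modelDeriv E F r x a) = modelDeriv E E (retract hρ h) x a := by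
  rw [← modelDeriv_comp (R.mdifferentiableAt_incl _) (R.mdifferentiableAt_proj x),
    show ι ∘ r = retract hρ h from funext R.incl_proj]

variable [T2Space M] [FiniteDimensional ℝ E] [FiniteDimensional ℝ g]

lemma modelDeriv_apply_incl (R : IsReduction c F hρ h ι r) (n : N) (a : F) :
    modelDeriv E V h (ι n) (modelDeriv F E ι n a) = 0 := by
  have h1 := R.isMomentumMap.mfderiv_apply_mfderiv_retract R.isSymplectic hρ R.apply_eq R.isAlt
    R.isCompl (ι n) (modelDeriv F E ι n a)
  rw [← R.modelDeriv_incl_proj, R.modelDeriv_proj_incl, ← R.incl_proj, R.proj_incl] at h1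
  exact h1

/-- The splitting of the symplectic form. -/
theorem modelForm_eq_add (R : IsReduction c F hρ h ι r) (x : M) (a b : E) :
    σ.modelForm x ![a, b] = c (modelDeriv E V h x a) (modelDeriv E V h x b) +
      (σ.pullback (F := F) ι).modelForm (r x) ![modelDeriv E F r x a, modelDeriv E F r x b] := by
  rw [TwoForm.modelForm_pullback, R.modelDeriv_incl_proj, R.modelDeriv_incl_proj, R.incl_proj]
  exact R.isMomentumMap.apply_eq_add R.isSymplectic hρ R.apply_eq R.isAlt R.isCompl x a b

theorem isSymplectic_pullback [FiniteDimensional ℝ F] [IsManifold 𝓘(ℝ, F) ∞ N]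
    (R : IsReduction c F hρ h ι r) : (σ.pullback (F := F) ι).IsSymplectic := by
  refine R.isSymplectic.pullback R.contMDiff_incl fun n a ha ↦ ?_
  have h1 : modelDeriv F E ι n a = 0 := by
    refine R.isSymplectic.nondegenerate (ι n) (modelDeriv F E ι n a) fun b ↦ ?_
    refine (R.modelForm_eq_add (ι n) (modelDeriv F E ι n a) b).trans ?_
    rw [R.modelDeriv_apply_incl, R.modelDeriv_proj_incl, R.proj_incl, ha, Submodule.coe_zero,
      map_zero, LinearMap.zero_apply, add_zero]
  exact R.modelDeriv_incl_injective n (h1.trans (map_zero _).symm)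

/-- The derivative of the inclusion on the projected vector field. -/
lemma modelDeriv_incl_fieldAt (R : IsReduction c F hρ h ι r) (u : g) (x : M) :
    modelDeriv F E ι (r x) (modelDeriv E F r x (ρ.fieldAt u x)) =
      ρ.fieldAt (u - V.projectionOnto (LinearMap.ker c) R.isCompl u) (ι (r x)) := by
  rw [R.modelDeriv_incl_proj, R.incl_proj]
  exact R.isMomentumMap.mfderiv_retract_vectorField R.isSymplectic hρ R.apply_eq R.isAlt
    R.isCompl u x

lemma modelDeriv_incl_fieldAt_incl (R : IsReduction c F hρ h ι r) (u : g) (n : N) :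
    modelDeriv F E ι n (modelDeriv E F r (ι n) (ρ.fieldAt u (ι n))) =
      ρ.fieldAt (u - V.projectionOnto (LinearMap.ker c) R.isCompl u) (ι n) := by
  have h1 := R.modelDeriv_incl_fieldAt u (ι n)
  rwa [R.proj_incl] at h1

/-- The fundamental vector fields are projectable to the zero level. -/
lemma modelDeriv_proj_fieldAt (R : IsReduction c F hρ h ι r) (u : g) (x : M) :
    modelDeriv E F r x (ρ.fieldAt u x) =
      modelDeriv E F r (ι (r x)) (ρ.fieldAt u (ι (r x))) := by
  refine R.modelDeriv_incl_injective (r x) ?_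
  rw [R.modelDeriv_incl_fieldAt, R.modelDeriv_incl_fieldAt_incl]

lemma modelForm_pullback_fieldAt (R : IsReduction c F hρ h ι r) (u v : g) (n : N) :
    (σ.pullback (F := F) ι).modelForm n ![modelDeriv E F r (ι n) (ρ.fieldAt u (ι n)),
      modelDeriv E F r (ι n) (ρ.fieldAt v (ι n))] = 0 := by
  rw [TwoForm.modelForm_pullback, R.modelDeriv_incl_fieldAt_incl, R.modelDeriv_incl_fieldAt_incl]
  refine (R.apply_eq _ _ _).trans ?_
  rw [map_sub, R.isAlt.apply_projectionOnto_right, sub_self]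

/-- The pairing of the projected vector field with a vector tangent to the zero level. -/
lemma modelForm_fieldAt_incl (R : IsReduction c F hρ h ι r) (u : g) (n : N) (a : F) :
    (σ.pullback (F := F) ι).modelForm n ![modelDeriv E F r (ι n) (ρ.fieldAt u (ι n)), a] =
      σ.modelForm (ι n) ![ρ.fieldAt u (ι n), modelDeriv F E ι n a] := by
  set v := V.projectionOnto (LinearMap.ker c) R.isCompl u with hv
  have h1 : ρ.fieldAt u (ι n) = ρ.fieldAt (u - v) (ι n) + ρ.fieldAt v (ι n) := by
    rw [← fieldAt_add, sub_add_cancel]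
  rw [TwoForm.modelForm_pullback, R.modelDeriv_incl_fieldAt_incl, h1,
    ContinuousAlternatingMap.apply_add_left,
    R.isMomentumMap.apply_eq_zero v.2 (R.modelDeriv_apply_incl n a), add_zero]

variable [IsManifold 𝓘(ℝ, F) ∞ N]

/-- The function `H_u` on the zero level is a Hamiltonian function of the projected vector field. -/
lemma isHamiltonianPair (R : IsReduction c F hρ h ι r) (u : g) :
    (σ.pullback (F := F) ι).IsHamiltonianPair (fun n ↦ ρ.hamiltonian u (ι n))
      (fun n ↦ modelDeriv E F r (ι n) (ρ.fieldAt u (ι n))) where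
  contMDiff_field := R.contMDiff_field u
  contMDiff_function := (ρ.hamiltonian u).contMDiff.comp R.contMDiff_incl
  isHamiltonianVectorField n a := by
    refine (mfderiv_comp_apply n ((ρ.hamiltonian u).contMDiff.mdifferentiableAt (by simp))
      (R.mdifferentiableAt_incl n) a).trans ?_
    exact (ρ.isHamiltonianVectorField u (ι n) _).trans (R.modelForm_fieldAt_incl u n a).symm

/-- The action on the zero level. -/
noncomputable def action [FiniteDimensional ℝ F] [IsLieAbelian g] (R : IsReduction c F hρ h ι r) :
    WeaklyHamiltonianAction (σ.pullback (F := F) ι) g where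
  vectorField :=
    { toFun := fun u n ↦ modelDeriv E F r (ι n) (ρ.fieldAt u (ι n))
      map_add' := fun u v ↦ funext fun n ↦ by
        rw [fieldAt_add, map_add]
        rfl
      map_smul' := fun t u ↦ funext fun n ↦
        (congrArg (modelDeriv E F r (ι n)) (congrFun (map_smul ρ.vectorField t u) (ι n))).trans
          (map_smul (modelDeriv E F r (ι n)) t (ρ.fieldAt u (ι n))) }
  smooth_vectorField := R.contMDiff_field
  map_lie u v := by
    rw [trivial_lie_zero, map_zero]
    exact (neg_eq_zero.2 (R.isSymplectic_pullback.mlieBracket_eq_zero_of_apply_eq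
      (R.isHamiltonianPair u) (R.isHamiltonianPair v) (R.modelForm_pullback_fieldAt u v))).symm
  hamiltonian :=
    { toFun := fun u ↦ ⟨fun n ↦ ρ.hamiltonian u (ι n),
        (ρ.hamiltonian u).contMDiff.comp R.contMDiff_incl⟩
      map_add' := fun u v ↦ ContMDiffMap.ext fun n ↦
        DFunLike.congr_fun (map_add ρ.hamiltonian u v) (ι n)
      map_smul' := fun t u ↦ ContMDiffMap.ext fun n ↦
        DFunLike.congr_fun (map_smul ρ.hamiltonian t u) (ι n) }
  isHamiltonianVectorField u := (R.isHamiltonianPair u).isHamiltonianVectorField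

variable [FiniteDimensional ℝ F] [IsLieAbelian g]

lemma isHamiltonian_action (R : IsReduction c F hρ h ι r) : R.action.IsHamiltonian := fun u v n ↦
  (cocycle_eq _ u v n).trans (R.modelForm_pullback_fieldAt u v n)

lemma action_vectorField_eq_zero (R : IsReduction c F hρ h ι r) {v : g} (hv : v ∈ V) :
    R.action.vectorField v = 0 := by
  ext1 n
  refine R.modelDeriv_incl_injective n ((R.modelDeriv_incl_fieldAt_incl v n).trans ?_)
  rw [Submodule.projectionOnto_apply_left R.isCompl ⟨v, hv⟩, sub_self]
  exact (congrFun (map_zero ρ.vectorField) (ι n)).trans (map_zero (modelDeriv F E ι n)).symm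

/-- Integral curves in `M` project to integral curves in the zero level. -/
lemma isComplete_action (R : IsReduction c F hρ h ι r) : R.action.IsComplete := by
  intro u n
  obtain ⟨γ, hγ0, hγ⟩ := hρ u (ι n)
  refine ⟨r ∘ γ, by rw [Function.comp_apply, hγ0, R.proj_incl], fun t ↦ ?_⟩
  refine ((R.mdifferentiableAt_proj (γ t)).hasMFDerivAt.comp t (hγ t)).congr_mfderiv ?_
  refine ContinuousLinearMap.ext_ring ?_
  refine (map_smul (modelDeriv E F r (γ t)) (1 : ℝ) (ρ.fieldAt u (γ t))).trans ?_
  exact congrArg ((1 : ℝ) • · : F → F) (R.modelDeriv_proj_fieldAt u (γ t))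

end IsReduction

end WeaklyHamiltonianAction

end Reduction

/-! ### The splitting theorem -/

theorem mainTheorem3
    {E : Type*} [NormedAddCommGroup E] [NormedSpace ℝ E] [FiniteDimensional ℝ E]
    {M : Type*} [TopologicalSpace M] [T2Space M] [SecondCountableTopology M] [ConnectedSpace M]
    [ChartedSpace E M] [IsManifold 𝓘(ℝ, E) ∞ M]
    (σ : TwoForm E M) (hσ : σ.IsSymplectic)
    {g : Type*} [NormedLieRing g] [NormedLieAlgebra g] [FiniteDimensional ℝ g] [IsLieAbelian g]
    (ρ : WeaklyHamiltonianAction σ g) (hρ : ρ.IsComplete) :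
    -- the cocycle is a constant alternating form `c`
    ∃ c : LinearMap.BilinForm ℝ g, c.IsAlt ∧ (∀ u v x, ρ.cocycle u v x = c u v) ∧
      ∀ (V : Submodule ℝ g) (hV : IsCompl V (LinearMap.ker c)),
        -- `(V, c|_V)` is a symplectic vector space
        (c.restrict V).Nondegenerate ∧
        -- `N = {x | H_v(x) = 0 for all v ∈ V}` is an embedded symplectic submanifold
        ∃ (k : ℕ) (_ : ChartedSpace (EuclideanSpace ℝ (Fin k)) (ρ.zeroLevel V))
          (_ : IsManifold (𝓡 k) ∞ (ρ.zeroLevel V)),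
          Manifold.IsSmoothEmbedding (𝓡 k) 𝓘(ℝ, E) ∞ (Subtype.val : ρ.zeroLevel V → M) ∧
          (σ.pullback (F := EuclideanSpace ℝ (Fin k))
            (Subtype.val : ρ.zeroLevel V → M)).IsSymplectic ∧
          ∃ (Φ : Diffeomorph 𝓘(ℝ, E) (𝓘(ℝ, V).prod (𝓡 k)) M (V × ρ.zeroLevel V) ∞)
            (ρN : WeaklyHamiltonianAction (σ.pullback (F := EuclideanSpace ℝ (Fin k))
              (Subtype.val : ρ.zeroLevel V → M)) g),
            (∀ n : ρ.zeroLevel V, Φ n = (0, n)) ∧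
            -- `σ = Φ^*(c|_V ⊕ σ|_N)`
            (∀ (x : M) (a b : TangentSpace 𝓘(ℝ, E) x),
              σ x ![a, b] =
                c (mfderiv 𝓘(ℝ, E) (𝓘(ℝ, V).prod (𝓡 k)) Φ x a).1
                  (mfderiv 𝓘(ℝ, E) (𝓘(ℝ, V).prod (𝓡 k)) Φ x b).1 +
                σ.pullback (F := EuclideanSpace ℝ (Fin k))
                  (Subtype.val : ρ.zeroLevel V → M) (Φ x).2
                  ![(mfderiv 𝓘(ℝ, E) (𝓘(ℝ, V).prod (𝓡 k)) Φ x a).2,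
                    (mfderiv 𝓘(ℝ, E) (𝓘(ℝ, V).prod (𝓡 k)) Φ x b).2]) ∧
            -- the action on `N` is complete, Hamiltonian, and trivial along `V`
            ρN.IsComplete ∧ ρN.IsHamiltonian ∧ (∀ v ∈ V, ρN.vectorField v = 0) ∧
            -- `Φ` carries `X_u` to (translation by the `V`-component of `u`, action of `u` on `N`)
            (∀ (u : g) (x : M),
              mfderiv 𝓘(ℝ, E) (𝓘(ℝ, V).prod (𝓡 k)) Φ x (ρ.vectorField u x) =
                (V.projectionOnto (LinearMap.ker c) hV u, ρN.vectorField u (Φ x).2)) ∧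
            -- and the Hamiltonian functions split accordingly
            (∀ (u : g) (x : M),
              ρ.hamiltonian u x =
                c (V.projectionOnto (LinearMap.ker c) hV u) (Φ x).1 +
                  ρN.hamiltonian u (Φ x).2) := by
  obtain ⟨c, hcA, hc⟩ := ρ.exists_bilinForm hσ
  refine ⟨c, hcA, fun u v x ↦ (ρ.cocycle_eq u v x).trans (hc u v x), fun V hV ↦
    ⟨hcA.restrict_nondegenerate hV, ?_⟩⟩
  obtain ⟨h, hh⟩ := ρ.exists_isMomentumMap hcA hV
  obtain ⟨k, iC, iM, hemb, hsm⟩ := exists_isManifold_of_regular hh.contMDiff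
    (hh.mem_zeroLevel_iff hcA hV) fun x _ ↦ hh.mfderiv_surjective hc hcA hV x
  refine ⟨k, iC, iM, hemb, ?_⟩
  -- the projection to the zero level
  let r : M → ρ.zeroLevel V := fun x ↦ ⟨WeaklyHamiltonianAction.retract hρ h x,
    (hh.mem_zeroLevel_iff hcA hV _).2 (hh.apply_retract hρ hc hcA hV x)⟩
  have R : WeaklyHamiltonianAction.IsReduction c (EuclideanSpace ℝ (Fin k)) hρ h
      (Subtype.val : ρ.zeroLevel V → M) r :=
    { isSymplectic := hσ
      apply_eq := hc
      isAlt := hcA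
      isCompl := hV
      isMomentumMap := hh
      contMDiff_incl := hemb.contMDiff
      contMDiff_proj := hsm r (hh.contMDiff_retract hσ hρ hc)
      incl_proj := fun _ ↦ rfl
      proj_incl := fun n ↦ Subtype.ext (WeaklyHamiltonianAction.retract_of_eq_zero hρ
        ((hh.mem_zeroLevel_iff hcA hV _).1 n.2)) }
  have hret : ∀ (v : V) (n : ρ.zeroLevel V), h (WeaklyHamiltonianAction.act hρ v n) = v := by
    intro v n
    rw [hh.apply_act hρ hc hcA hV, R.apply_incl, Submodule.projectionOnto_apply_left, zero_add]
  let Φ : Diffeomorph 𝓘(ℝ, E) (𝓘(ℝ, V).prod (𝓡 k)) M (V × ρ.zeroLevel V) ∞ :=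
    { toFun := fun x ↦ (h x, r x)
      invFun := fun p ↦ WeaklyHamiltonianAction.act hρ (p.1 : g) p.2
      left_inv := fun x ↦ WeaklyHamiltonianAction.act_retract hσ hρ hc x
      right_inv := fun p ↦ by
        refine Prod.ext (hret p.1 p.2) (Subtype.ext ?_)
        change WeaklyHamiltonianAction.act hρ
          (-(h (WeaklyHamiltonianAction.act hρ (p.1 : g) p.2) : g)) _ = _
        rw [hret, ← WeaklyHamiltonianAction.act_add hσ hρ hc, neg_add_cancel,
          WeaklyHamiltonianAction.act_zero]
      contMDiff_toFun := hh.contMDiff.prodMk R.contMDiff_proj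
      contMDiff_invFun := (WeaklyHamiltonianAction.contMDiff_act_uncurry hσ hρ hc).comp
        ((V.subtypeL.contDiff.contMDiff.comp contMDiff_fst).prodMk
          (R.contMDiff_incl.comp contMDiff_snd)) }
  have hΦ : ∀ x (a : E), (mfderiv 𝓘(ℝ, E) (𝓘(ℝ, V).prod (𝓡 k)) Φ x a :
      V × EuclideanSpace ℝ (Fin k)) =
        (modelDeriv E V h x a, modelDeriv E (EuclideanSpace ℝ (Fin k)) r x a) := fun x a ↦
    DFunLike.congr_fun ((hh.contMDiff.mdifferentiableAt (by simp)).mfderiv_prod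
      (R.mdifferentiableAt_proj x)) a
  refine ⟨R.isSymplectic_pullback, Φ, R.action, fun n ↦ Prod.ext (R.apply_incl n) (R.proj_incl n),
    fun x a b ↦ ?_, R.isComplete_action, R.isHamiltonian_action,
    fun v hv ↦ R.action_vectorField_eq_zero hv, fun u x ↦ ?_, fun u x ↦ R.hamiltonian_eq_add u x⟩
  · exact (R.modelForm_eq_add x a b).trans (congrArg₂
      (fun p q : V × EuclideanSpace ℝ (Fin k) ↦ c p.1 q.1 + (σ.pullback
        (F := EuclideanSpace ℝ (Fin k)) (Subtype.val : ρ.zeroLevel V → M)).modelForm (r x)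
          ![p.2, q.2]) (hΦ x a) (hΦ x b)).symm
  · refine (hΦ x _).trans (Prod.ext (hh.mfderiv_vectorField hc hcA hV u x) ?_)
    exact R.modelDeriv_proj_fieldAt u x
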